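/- Let $(M^n,g_M)$ be a connected (smooth) Riemannian manifold, let $\mathcal H:\mathbb R\times M\to\mathbb R$ be smooth, and let $\overline M^{n+2}=\mathbb R^2\times M^n$ be the plane fronted wave with the Lorentzian metric $$\langle\ ,\ \rangle=\mathcal H(u,x)\,du\otimes du+du\otimes dv+dv\otimes du+g_M ,$$ where $(u,v)$ are the natural coordinates on $\mathbb R^2$. Call a Riemannian manifold \emph{parabolic} if it is complete and every ($C^2$) function $f$ on it with $\Delta f\le 0$ that is bounded from below is constant, where $\Delta=\operatorname{div}\nabla$ (compact manifolds are allowed). Let $\psi:\Sigma^k\to\overline M^{n+2}$ be a connected spacelike submanifold, i.e. a smooth immersion of a connected manifold whose induced metric is Riemannian, let $\overrightarrow H=\frac1k\operatorname{trace}(\mathrm{II})$ be its mean curvature vector field, put $\mu=u\circ\psi$, and assume that $\Sigma^k$ with the induced metric is parabolic. If $\langle\overrightarrow H,\partial_v\rangle\ge 0$ on $\Sigma^k$ and $\sup_{\Sigma^k}\mu<+\infty$, or if $\langle\overrightarrow H,\partial_v\rangle\le 0$ on $\Sigma^k$ and $\inf_{\Sigma^k}\mu>-\infty$, then $\mu$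 is constant, $\mu=u_0$ for some $u_0\in\mathbb R$. If in addition $k=n$ (codimension two) and $\Sigma^n$ is simply connected, then for every $v_0\in\mathbb R$ the wavefront $\{u=u_0,\ v=v_0\}$, with its induced metric, is parabolic. -/

import Mathlib

open Set Filter Topology Bundle
open scoped Manifold ContDiff ENNReal

noncomputable section

namespace PlaneFrontedWave

section General

variable {E : Type*} [NormedAddCommGroup E] [NormedSpace ℝ E] [FiniteDimensional ℝ E]
  {H : Type*} [TopologicalSpace H]
  {E' : Type*} [NormedAddCommGroup E'] [NormedSpace ℝ E'] [FiniteDimensional ℝ E']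
  {H' : Type*} [TopologicalSpace H']

/-- A field of (semi-Riemannian) inner products `g x a b = ⟨a, b⟩_x` on the tangent spaces. -/
abbrev MetricField (I : ModelWithCorners ℝ E H) (M : Type*) [TopologicalSpace M]
    [ChartedSpace H M] : Type _ :=
  ∀ x : M, TangentSpace I x → TangentSpace I x → ℝ

/-- The inverse Gram matrix `(g^{ij})` of a bilinear form in a fixed basis of `E`. -/
def invGram (B : E → E → ℝ) :
    Matrix (Fin (Module.finrank ℝ E)) (Fin (Module.finrank ℝ E)) ℝ :=
  (Matrix.of fun i j => B (Module.finBasis ℝ E i) (Module.finBasis ℝ E j))⁻¹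

/-- The metric trace `∑ g^{ij} S(e_i, e_j)` of a (possibly vector-valued) bilinear map `S`. -/
def metricTrace {F : Type*} [AddCommGroup F] [Module ℝ F] (B : E → E → ℝ) (S : E → E → F) : F :=
  ∑ i, ∑ j, invGram B i j • S (Module.finBasis ℝ E i) (Module.finBasis ℝ E j)

variable {I : ModelWithCorners ℝ E H} {I' : ModelWithCorners ℝ E' H'}
  {M : Type*} [TopologicalSpace M] [ChartedSpace H M]
  {M' : Type*} [TopologicalSpace M'] [ChartedSpace H' M']

/-- The components of the metric `g` in the preferred chart at `p`, as a function of the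
coordinates `y`. -/
def metricInChart (g : MetricField I M) (p : M) (y : E) (a b : E) : ℝ :=
  g ((extChartAt I p).symm y)
    (mfderiv 𝓘(ℝ, E) I (extChartAt I p).symm y a)
    (mfderiv 𝓘(ℝ, E) I (extChartAt I p).symm y b)

/-- The Christoffel symbol of the first kind at `p`, in the preferred chart at `p`:
`½ (∂_a g(b, c) + ∂_b g(a, c) - ∂_c g(a, b))`. -/
def christoffelFirst (g : MetricField I M) (p : M) (a b c : E) : ℝ :=
  (fderiv ℝ (fun y => metricInChart g p y b c) (extChartAt I p p) a
    + fderiv ℝ (fun y => metricInChart g p y a c) (extChartAt I p p) b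
    - fderiv ℝ (fun y => metricInChart g p y a b) (extChartAt I p p) c) / 2

/-- The Christoffel symbol (of the second kind) of the Levi-Civita connection of `g` at `p`, in
the preferred chart at `p`: the value at `p` of `∇_a b`, where `a` and `b` are extended to fields
with constant components in this chart. It is
`Γ(a, b) = ∑ g^{ij} Γ(a, b; e_j) e_i`. -/
def christoffel (g : MetricField I M) (p : M) (a b : E) : E :=
  ∑ i, ∑ j, (invGram (metricInChart g p (extChartAt I p p)) i j
    * christoffelFirst g p a b (Module.finBasis ℝ E j)) • Module.finBasis ℝ E i

/-- The second derivative at `p` of a map between manifolds, written in the preferred charts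
at `p` and at `ψ p`. -/
def secondDerivInChart (I : ModelWithCorners ℝ E H) (I' : ModelWithCorners ℝ E' H')
    (ψ : M → M') (p : M) (a b : E) : E' :=
  fderiv ℝ (fun y => fderiv ℝ (writtenInExtChartAt I I' p ψ) y b) (extChartAt I p p) a

/-- The Hessian `∇df` of a function on a manifold with a metric. -/
def hessian (g : MetricField I M) (f : M → ℝ) (p : M) (a b : TangentSpace I p) : ℝ :=
  let df : E → ℝ := mfderiv I 𝓘(ℝ, ℝ) f p
  secondDerivInChart (E := E) (E' := ℝ) I 𝓘(ℝ, ℝ) f p a b - df (christoffel (E := E) g p a b)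

/-- The Laplacian `Δf = div (grad f) = trace (∇df)`. -/
def laplacian (g : MetricField I M) (f : M → ℝ) (p : M) : ℝ :=
  metricTrace (E := E) (g p) (hessian g f p)

/-- The metric induced on `M` by a map `ψ : M → M'` into a manifold with metric `g'`. -/
def inducedMetric (I : ModelWithCorners ℝ E H) (g' : MetricField I' M') (ψ : M → M') :
    MetricField I M :=
  fun p a b => g' (ψ p) (mfderiv I I' ψ p a) (mfderiv I I' ψ p b)

/-- A spacelike submanifold: a smooth immersion whose induced metric is Riemannian. -/
structure IsSpacelikeSubmanifold (I : ModelWithCorners ℝ E H) (g' : MetricField I' M')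
    (ψ : M → M') : Prop where
  contMDiff : ContMDiff I I' ∞ ψ
  immersion : ∀ p, Function.Injective (mfderiv I I' ψ p)
  spacelike : ∀ (p : M) (a : TangentSpace I p), a ≠ 0 → 0 < inducedMetric I g' ψ p a a

/-- The ambient covariant derivative at `p` along `ψ`: the value at `p` of `∇̄_a (dψ b)`, where `b`
is extended to the field with constant components in the preferred chart at `p`. -/
def ambientCovDeriv (I : ModelWithCorners ℝ E H) (g' : MetricField I' M') (ψ : M → M') (p : M)
    (a b : TangentSpace I p) : TangentSpace I' (ψ p) :=
  secondDerivInChart (E := E) (E' := E') I I' ψ p a b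
    + christoffel (E := E') g' (ψ p) (mfderiv I I' ψ p a) (mfderiv I I' ψ p b)

/-- The second fundamental form, from the Gauss formula: `II(a, b) = ∇̄_a b - ∇_a b`, with `∇̄` and
`∇` the Levi-Civita connections of the ambient metric and of the induced metric. -/
def secondFundamentalForm (I : ModelWithCorners ℝ E H) (g' : MetricField I' M') (ψ : M → M')
    (p : M) (a b : TangentSpace I p) : TangentSpace I' (ψ p) :=
  ambientCovDeriv I g' ψ p a b - mfderiv I I' ψ p (christoffel (E := E) (inducedMetric I g' ψ) p a b)

/-- The mean curvature vector `(1/k) trace II`, where `k` is the dimension of the submanifold. -/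
def meanCurvature (I : ModelWithCorners ℝ E H) (g' : MetricField I' M') (ψ : M → M') (p : M) :
    TangentSpace I' (ψ p) :=
  (1 / (Module.finrank ℝ E : ℝ)) •
    metricTrace (E := E) (inducedMetric I g' ψ p) (secondFundamentalForm I g' ψ p)

/-- The Riemannian distance: the infimum of the lengths of `C^1` paths, where the length of a
tangent vector is `√(g(a, a))`. -/
def riemDist (g : MetricField I M) (x y : M) : ℝ≥0∞ :=
  letI : ∀ z : M, ENorm (TangentSpace I z) := fun z => ⟨fun a => ENNReal.ofReal √(g z a a)⟩
  Manifold.riemannianEDist I x y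

/-- Completeness for the Riemannian distance: every Cauchy sequence converges. -/
def IsCompleteMetric (g : MetricField I M) : Prop :=
  ∀ s : ℕ → M,
    (∀ ε : ℝ≥0∞, 0 < ε → ∃ N, ∀ i j, N ≤ i → N ≤ j → riemDist g (s i) (s j) < ε) →
    ∃ x, Tendsto (fun i => riemDist g (s i) x) atTop (𝓝 0)

/-- Parabolicity: the metric is complete, and every superharmonic function bounded from below is
constant. (Every compact manifold is then parabolic.) -/
structure IsParabolic (g : MetricField I M) : Prop where
  complete : IsCompleteMetric g
  eq_const : ∀ f : M → ℝ, ContMDiff I 𝓘(ℝ, ℝ) 2 f → (∀ x, laplacian g f x ≤ 0) →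
    BddBelow (range f) → ∃ c, ∀ x, f x = c

end General

section Wave

variable {n : ℕ} {M : Type*} [TopologicalSpace M] [ChartedSpace (EuclideanSpace ℝ (Fin n)) M]

/-- The model with corners of `ℝ² × M`. -/
abbrev waveModel (n : ℕ) : ModelWithCorners ℝ ((ℝ × ℝ) × EuclideanSpace ℝ (Fin n))
    (ModelProd (ℝ × ℝ) (EuclideanSpace ℝ (Fin n))) :=
  𝓘(ℝ, ℝ × ℝ).prod (𝓡 n)

/-- The metric `𝓗(u, x) du ⊗ du + du ⊗ dv + dv ⊗ du + g_M` of a plane fronted wave, at the point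
`((u, v), x)` of `ℝ² × M`. The tangent space is `(ℝ × ℝ) × T_x M`, with `a.1.1 = du(a)` and
`a.1.2 = dv(a)`. -/
def waveMetric [IsManifold (𝓡 n) ∞ M]
    (gM : ContMDiffRiemannianMetric (𝓡 n) ∞ (EuclideanSpace ℝ (Fin n))
      (TangentSpace (𝓡 n) : M → Type _))
    (𝓗 : ℝ × M → ℝ) : MetricField (waveModel n) ((ℝ × ℝ) × M) :=
  fun q (a b : (ℝ × ℝ) × EuclideanSpace ℝ (Fin n)) =>
    𝓗 (q.1.1, q.2) * a.1.1 * b.1.1 + a.1.1 * b.1.2 + a.1.2 * b.1.1 + gM.inner q.2 a.2 b.2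

/-- The coordinate vector field `∂_v`. -/
def partialV (q : (ℝ × ℝ) × M) : TangentSpace (waveModel n) q :=
  (((0, 1), 0) : (ℝ × ℝ) × EuclideanSpace ℝ (Fin n))

/-- The wavefront `u = u₀`, `v = v₀`, as an embedding of `M`. -/
def wavefront (u₀ v₀ : ℝ) (x : M) : (ℝ × ℝ) × M := ((u₀, v₀), x)

end Wave

end PlaneFrontedWave

end

/-!
The field `∂_v` is the gradient of the coordinate `u`, and it is parallel. So `u` has zero Hessian,
and for a spacelike submanifold `ψ` of dimension `k` the Laplacian of `u ∘ ψ` is `k ⟨H, ∂_v⟩`.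
Parabolicity then makes `u ∘ ψ` constant.

Once `du` vanishes along `ψ`, the induced metric is the pullback of `g_M` under the projection of
`ψ` to `M`. When `k = n` this projection is thus a local isometry with complete domain, along which
paths of finite length lift: it is onto, and `M` is complete. The second fundamental form of a local
isometry is zero, so a superharmonic function on `M` bounded from below pulls back to such a
function on `Σ`, and is therefore constant.
-/

noncomputable section

namespace PlaneFrontedWave

section MetricSpaces

/-- The Brezis–Browder ordering principle. -/
theorem exists_ge_forall_ge_eq {X : Type*} [Preorder X] {f : X → ℝ} (hf : Monotone f)
    (hbdd : BddAbove (range f)) (hseq : ∀ u : ℕ → X, Monotone u → BddAbove (range u)) (x : X) :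
    ∃ m, x ≤ m ∧ ∀ y, m ≤ y → f y = f m := by
  have exists_half (y : X) : ∃ z, y ≤ z ∧ ∀ w, y ≤ w → f w - f z ≤ f z - f y := by
    by_contra! h
    have hne : (f '' Ici y).Nonempty := ⟨f y, y, self_mem_Ici, rfl⟩
    have hb : BddAbove (f '' Ici y) := hbdd.mono (image_subset_range f _)
    obtain ⟨w, hw, hlt⟩ := h y le_rfl
    have hsup : f w ≤ sSup (f '' Ici y) := le_csSup hb ⟨w, hw, rfl⟩
    obtain ⟨-, ⟨z, hz, rfl⟩, hfz⟩ :=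
      exists_lt_of_lt_csSup hne (show (f y + sSup (f '' Ici y)) / 2 < _ by linarith)
    obtain ⟨w', hw', hlt'⟩ := h z hz
    linarith [le_csSup hb ⟨w', hw', rfl⟩]
  choose next le_next next_half using exists_half
  let u : ℕ → X := fun k => next^[k] x
  have hu_succ (k : ℕ) : u (k + 1) = next (u k) := Function.iterate_succ_apply' next k x
  have hu : Monotone u := monotone_nat_of_le_succ fun k => hu_succ k ▸ le_next (u k)
  obtain ⟨m, hm⟩ := hseq u hu
  replace hm (k : ℕ) : u k ≤ m := hm ⟨k, rfl⟩
  refine ⟨m, hm 0, fun y hy => (hf hy).antisymm' ?_⟩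
  have hlim := tendsto_atTop_ciSup (hf.comp hu) (hbdd.mono (range_comp_subset_range u f))
  have hdiff : Tendsto (fun k => f (u (k + 1)) - f (u k)) atTop (𝓝 0) := by
    simpa using (hlim.comp (tendsto_add_atTop_nat 1)).sub hlim
  refine sub_nonpos.1 (ge_of_tendsto' hdiff fun k => ?_)
  linarith [hf (hm (k + 1)), hu_succ k ▸ next_half (u k) y ((hm k).trans hy)]

theorem cauchySeq_of_edist_le_of_monotone {X : Type*} [PseudoEMetricSpace X] {q : ℕ → X}
    {a : ℕ → ℝ} (ha : Monotone a) (hbdd : BddAbove (range a))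
    (h : ∀ i j, i ≤ j → edist (q i) (q j) ≤ ENNReal.ofReal (a j - a i)) : CauchySeq q := by
  have key (i j : ℕ) : edist (q i) (q j) ≤ edist (a i) (a j) := by
    wlog hij : i ≤ j generalizing i j
    · simpa only [edist_comm] using this j i (le_of_not_ge hij)
    · rw [edist_comm (a i), edist_dist, Real.dist_eq, abs_of_nonneg (sub_nonneg.2 (ha hij))]
      exact h i j hij
  have hcauchy : CauchySeq a := (tendsto_atTop_ciSup ha hbdd).cauchySeq
  rw [EMetric.cauchySeq_iff] at hcauchy ⊢
  exact fun ε hε => (hcauchy ε hε).imp fun N hN i hi j hj => (key i j).trans_lt (hN i hi j hj)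

theorem edist_le_ofReal_add {X : Type*} [PseudoEMetricSpace X] {x y z : X} {a b c : ℝ}
    (hab : a ≤ b) (hbc : b ≤ c) (hxy : edist x y ≤ ENNReal.ofReal (b - a))
    (hyz : edist y z ≤ ENNReal.ofReal (c - b)) : edist x z ≤ ENNReal.ofReal (c - a) := by
  rw [← sub_add_sub_cancel' b a c, ENNReal.ofReal_add (sub_nonneg.2 hab) (sub_nonneg.2 hbc)]
  exact (edist_triangle x y z).trans (add_le_add hxy hyz)

theorem isClosed_setOf_apply_eq {T X Y : Type*} [TopologicalSpace T] [TopologicalSpace X]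
    [TopologicalSpace Y] [T2Space Y] {φ : X → Y} (hφ : Continuous φ) {γ : T → Y} {s : Set T}
    (hs : IsClosed s) (hγ : ContinuousOn γ s) :
    IsClosed {x : T × X | x.1 ∈ s ∧ φ x.2 = γ x.1} := by
  have hpair : ContinuousOn (fun x : T × X => (φ x.2, γ x.1)) (Prod.fst ⁻¹' s) :=
    (hφ.comp continuous_snd).continuousOn.prodMk (hγ.comp continuousOn_fst fun _ => id)
  exact hpair.preimage_isClosed_of_isClosed (hs.preimage continuous_fst) isClosed_diagonal

theorem exists_lift_of_forall_exists_gt {X Y : Type*} [PseudoEMetricSpace X] [CompleteSpace X]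
    [TopologicalSpace Y] [T2Space Y] {φ : X → Y} (hφ : Continuous φ) {γ : ℝ → Y} {a b : ℝ}
    (hab : a ≤ b) (hγ : ContinuousOn γ (Icc a b)) {ℓ : ℝ → ℝ} (hℓ : MonotoneOn ℓ (Icc a b))
    (hstep : ∀ t ∈ Ico a b, ∀ q, φ q = γ t →
      ∃ t' ∈ Ioc t b, ∃ q', φ q' = γ t' ∧ edist q q' ≤ ENNReal.ofReal (ℓ t' - ℓ t))
    {p : X} (hp : φ p = γ a) : ∃ q, φ q = γ b ∧ edist p q ≤ ENNReal.ofReal (ℓ b - ℓ a) := by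
  let R : Set (ℝ × X) := {x | x.1 ∈ Icc a b ∧ φ x.2 = γ x.1}
  have hR : IsClosed R := isClosed_setOf_apply_eq hφ isClosed_Icc hγ
  have hℓ' {x y : R} (h : x.1.1 ≤ y.1.1) : ℓ x.1.1 ≤ ℓ y.1.1 := hℓ x.2.1 y.2.1 h
  let _ : Preorder R :=
    { le := fun x y => x.1.1 ≤ y.1.1 ∧ edist x.1.2 y.1.2 ≤ ENNReal.ofReal (ℓ y.1.1 - ℓ x.1.1)
      le_refl := fun x => ⟨le_rfl, by simp⟩
      le_trans := fun x y z hxy hyz =>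
        ⟨hxy.1.trans hyz.1, edist_le_ofReal_add (hℓ' hxy.1) (hℓ' hyz.1) hxy.2 hyz.2⟩ }
  have hfst : Monotone fun x : R => x.1.1 := fun x y hxy => hxy.1
  have hbdd : BddAbove (range fun x : R => x.1.1) :=
    ⟨b, forall_mem_range.2 fun x => x.2.1.2⟩
  have hseq (u : ℕ → R) (hu : Monotone u) : BddAbove (range u) := by
    have hsub : BddAbove (range fun i => (u i).1.1) :=
      hbdd.mono (range_comp_subset_range u fun x : R => x.1.1)
    have ht := tendsto_atTop_ciSup (hfst.comp hu) hsub
    have hℓu : Monotone fun i => ℓ (u i).1.1 := fun i j hij => hℓ' (hu hij).1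
    have hℓbdd : BddAbove (range fun i => ℓ (u i).1.1) := by
      refine ⟨ℓ b, forall_mem_range.2 fun i => ?_⟩
      exact hℓ (u i).2.1 (right_mem_Icc.2 hab) (u i).2.1.2
    obtain ⟨q, hq⟩ := cauchySeq_tendsto_of_complete
      (cauchySeq_of_edist_le_of_monotone hℓu hℓbdd fun i j hij => (hu hij).2)
    have hlim : (⨆ i, (u i).1.1, q) ∈ R :=
      hR.mem_of_tendsto (ht.prodMk_nhds hq) (.of_forall fun i => (u i).2)
    refine ⟨⟨_, hlim⟩, forall_mem_range.2 fun i => ⟨le_ciSup hsub i, ?_⟩⟩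
    refine le_of_tendsto (tendsto_const_nhds.edist hq)
      ((eventually_ge_atTop i).mono fun j hij => ?_)
    refine (hu hij).2.trans (ENNReal.ofReal_le_ofReal (sub_le_sub_right ?_ _))
    exact hℓ (u j).2.1 hlim.1 (le_ciSup hsub j)
  -- A lift over a maximal `t` ends at `b`, since `hstep` extends every lift which stops earlier.
  obtain ⟨m, hpm, hm⟩ := exists_ge_forall_ge_eq hfst hbdd hseq ⟨(a, p), left_mem_Icc.2 hab, hp⟩
  have hmb : m.1.1 = b := by
    refine m.2.1.2.eq_of_not_lt fun hlt => ?_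
    obtain ⟨t, ht, q, hq, hd⟩ := hstep _ ⟨m.2.1.1, hlt⟩ _ m.2.2
    exact ht.1.ne' (hm ⟨(t, q), ⟨m.2.1.1.trans ht.1.le, ht.2⟩, hq⟩ ⟨ht.1.le, hd⟩)
  exact ⟨m.1.2, hmb ▸ m.2.2, hmb ▸ hpm.2⟩

theorem completeSpace_of_surjective_of_lift {X Y : Type*} [PseudoEMetricSpace X] [CompleteSpace X]
    [PseudoEMetricSpace Y] {φ : X → Y} (hφ : LipschitzWith 1 φ) (hsurj : Function.Surjective φ)
    (hlift : ∀ x y r, edist (φ x) y < r → ∃ x', φ x' = y ∧ edist x x' < r) : CompleteSpace Y := by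
  refine EMetric.complete_of_convergent_controlled_sequences (fun k => (1 / 2) ^ k)
    (fun k => ENNReal.pow_pos (by simp) k) fun s hs => ?_
  choose! lift lift_apply edist_lift using fun x y r => hlift x y r
  obtain ⟨x₀, hx₀⟩ := hsurj (s 0)
  let x : ℕ → X := fun k => k.rec x₀ fun k z => lift z (s (k + 1)) ((1 / 2) ^ k)
  have hstep (k : ℕ) (hk : φ (x k) = s k) : edist (φ (x k)) (s (k + 1)) < (1 / 2) ^ k :=
    hk ▸ hs k k (k + 1) le_rfl k.le_succ
  have hx (k : ℕ) : φ (x k) = s k := by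
    induction k with
    | zero => exact hx₀
    | succ k ih => exact lift_apply _ _ _ (hstep k ih)
  have hcauchy : CauchySeq x := by
    refine cauchySeq_of_edist_le_geometric (1 / 2) 1 (by simp) ENNReal.one_ne_top fun k => ?_
    rw [one_mul]
    exact (edist_lift _ _ _ (hstep k (hx k))).le
  obtain ⟨z, hz⟩ := cauchySeq_tendsto_of_complete hcauchy
  exact ⟨φ z, ((hφ.continuous.tendsto z).comp hz).congr hx⟩

end MetricSpaces

section Length

variable {E : Type*} [NormedAddCommGroup E] [NormedSpace ℝ E]
  {H : Type*} [TopologicalSpace H] {I : ModelWithCorners ℝ E H}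
  {E' : Type*} [NormedAddCommGroup E'] [NormedSpace ℝ E']
  {H' : Type*} [TopologicalSpace H'] {I' : ModelWithCorners ℝ E' H'}
  {M : Type*} [TopologicalSpace M] [ChartedSpace H M]
  {M' : Type*} [TopologicalSpace M'] [ChartedSpace H' M']
  {g : MetricField I M} {g' : MetricField I' M'}

/-- The length `√(g(a, a))` of a tangent vector, as the extended norm which Mathlib's lengths of
paths expect. -/
abbrev metricENorm (g : MetricField I M) (x : M) : ENorm (TangentSpace I x) :=
  ⟨fun a => ENNReal.ofReal √(g x a a)⟩

/-- The length of the path `γ` between the parameters `a` and `b`, for the metric `g`. -/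
def metricLength (g : MetricField I M) (γ : ℝ → M) (a b : ℝ) : ℝ≥0∞ :=
  let _ := metricENorm g
  Manifold.pathELength I γ a b

theorem enormSMulClass_metricENorm (hg : ∀ x, IsBilinearMap ℝ (g x)) (x : M) :
    let _ := metricENorm g x
    ENormSMulClass ℝ (TangentSpace I x) := by
  let _ := metricENorm g x
  refine ⟨fun c a => ?_⟩
  change ENNReal.ofReal √(g x (c • a) (c • a)) = ‖c‖ₑ * ENNReal.ofReal √(g x a a)
  rw [(hg x).smul_left, (hg x).smul_right, smul_smul, smul_eq_mul,
    Real.sqrt_mul (mul_self_nonneg c), Real.sqrt_mul_self_eq_abs, ENNReal.ofReal_mul (abs_nonneg c),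
    ← Real.enorm_eq_ofReal_abs]

theorem metricLength_add (g : MetricField I M) (γ : ℝ → M) {a b c : ℝ} (hab : a ≤ b) (hbc : b ≤ c) :
    metricLength g γ a b + metricLength g γ b c = metricLength g γ a c :=
  let _ := metricENorm g
  Manifold.pathELength_add hab hbc

theorem metricLength_mono (g : MetricField I M) (γ : ℝ → M) {a b a' b' : ℝ} (ha : a' ≤ a)
    (hb : b ≤ b') : metricLength g γ a b ≤ metricLength g γ a' b' :=
  let _ := metricENorm g
  Manifold.pathELength_mono ha hb

theorem metricLength_congr (g : MetricField I M) {γ γ' : ℝ → M} {a b : ℝ}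
    (h : EqOn γ γ' (Icc a b)) : metricLength g γ a b = metricLength g γ' a b :=
  let _ := metricENorm g
  Manifold.pathELength_congr h

theorem metricLength_comp (g' : MetricField I' M') {φ : M → M'} (hφ : MDifferentiable I I' φ)
    {γ : ℝ → M} {a b : ℝ} (hγ : ContMDiffOn 𝓘(ℝ, ℝ) I 1 γ (Icc a b)) :
    metricLength g' (φ ∘ γ) a b = metricLength (inducedMetric I g' φ) γ a b := by
  let _ := metricENorm g'
  let _ := metricENorm (inducedMetric I g' φ)
  unfold metricLength
  rw [Manifold.pathELength_eq_lintegral_mfderiv_Ioo, Manifold.pathELength_eq_lintegral_mfderiv_Ioo]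
  refine MeasureTheory.setLIntegral_congr_fun measurableSet_Ioo fun t ht => ?_
  have hγt : MDifferentiableAt 𝓘(ℝ, ℝ) I γ t :=
    ((hγ t (Ioo_subset_Icc_self ht)).contMDiffAt (Icc_mem_nhds ht.1 ht.2)).mdifferentiableAt
      one_ne_zero
  simp only [mfderiv_comp t (hφ (γ t)) hγt]
  rfl

theorem isBilinearMap_inducedMetric (hg' : ∀ x, IsBilinearMap ℝ (g' x)) (φ : M → M') (x : M) :
    IsBilinearMap ℝ (inducedMetric I g' φ x) where
  add_left _ _ _ := by simp only [inducedMetric, map_add, (hg' _).add_left]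
  smul_left _ _ _ := by simp only [inducedMetric, map_smul, (hg' _).smul_left]
  add_right _ _ _ := by simp only [inducedMetric, map_add, (hg' _).add_right]
  smul_right _ _ _ := by simp only [inducedMetric, map_smul, (hg' _).smul_right]

/-- The Riemannian distance of `g` as a pseudo-distance on `M`. It is not an instance: its topology
is not definitionally, and for an indefinite `g` not at all, the one of `M`. -/
abbrev riemPseudoEMetricSpace (hg : ∀ x, IsBilinearMap ℝ (g x)) : PseudoEMetricSpace M :=
  let _ := metricENorm g
  have _ := enormSMulClass_metricENorm hg
  { edist := riemDist g
    edist_self _ := Manifold.riemannianEDist_self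
    edist_comm _ _ := Manifold.riemannianEDist_comm
    edist_triangle _ _ _ := Manifold.riemannianEDist_triangle }

theorem isCompleteMetric_iff (hg : ∀ x, IsBilinearMap ℝ (g x)) :
    IsCompleteMetric g ↔ @CompleteSpace M (riemPseudoEMetricSpace hg).toUniformSpace := by
  let _ := riemPseudoEMetricSpace hg
  refine ⟨fun h => UniformSpace.complete_of_cauchySeq_tendsto fun s hs => ?_, fun h s hs => ?_⟩
  · obtain ⟨x, hx⟩ := h s fun ε hε => (EMetric.cauchySeq_iff.1 hs ε hε).imp
      fun N hN i j hi hj => hN i hi j hj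
    exact ⟨x, tendsto_iff_edist_tendsto_0.2 hx⟩
  · obtain ⟨x, hx⟩ := cauchySeq_tendsto_of_complete (u := s) (EMetric.cauchySeq_iff.2 fun ε hε =>
      (hs ε hε).imp fun N hN i hi j hj => hN i j hi hj)
    exact ⟨x, tendsto_iff_edist_tendsto_0.1 hx⟩

theorem riemDist_le_metricLength (hg : ∀ x, IsBilinearMap ℝ (g x)) {γ : ℝ → M} {a b : ℝ}
    (hab : a ≤ b) (hγ : ContMDiffOn 𝓘(ℝ, ℝ) I 1 γ (Icc a b)) :
    riemDist g (γ a) (γ b) ≤ metricLength g γ a b :=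
  let _ := metricENorm g
  have _ := enormSMulClass_metricENorm hg
  Manifold.riemannianEDist_le_pathELength hγ rfl rfl hab

theorem exists_metricLength_lt_of_riemDist_lt {x y : M} {r : ℝ≥0∞} (h : riemDist g x y < r) :
    ∃ γ : ℝ → M, γ 0 = x ∧ γ 1 = y ∧ ContMDiffOn 𝓘(ℝ, ℝ) I 1 γ (Icc 0 1) ∧
      metricLength g γ 0 1 < r :=
  let _ := metricENorm g
  Manifold.exists_lt_of_riemannianEDist_lt h

theorem riemDist_apply_le (hg' : ∀ x, IsBilinearMap ℝ (g' x)) {φ : M → M'}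
    (hφ : ContMDiff I I' 1 φ) (p q : M) :
    riemDist g' (φ p) (φ q) ≤ riemDist (inducedMetric I g' φ) p q := by
  refine le_of_forall_gt fun r hr => ?_
  obtain ⟨γ, rfl, rfl, hγ, hlt⟩ := exists_metricLength_lt_of_riemDist_lt hr
  rw [← metricLength_comp g' (hφ.mdifferentiable one_ne_zero) hγ] at hlt
  exact (riemDist_le_metricLength hg' zero_le_one (hφ.comp_contMDiffOn hγ)).trans_lt hlt

end Length

section Charts

variable {E : Type*} [NormedAddCommGroup E] [NormedSpace ℝ E]
  {H : Type*} [TopologicalSpace H] {I : ModelWithCorners ℝ E H}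
  {E' : Type*} [NormedAddCommGroup E'] [NormedSpace ℝ E']
  {H' : Type*} [TopologicalSpace H'] {I' : ModelWithCorners ℝ E' H'}
  {E'' : Type*} [NormedAddCommGroup E''] [NormedSpace ℝ E'']
  {H'' : Type*} [TopologicalSpace H''] {I'' : ModelWithCorners ℝ E'' H''}
  {M : Type*} [TopologicalSpace M] [ChartedSpace H M]
  {M' : Type*} [TopologicalSpace M'] [ChartedSpace H' M']
  {M'' : Type*} [TopologicalSpace M''] [ChartedSpace H'' M'']

theorem metricField_congr (g : MetricField I M) {x y : M} (h : x = y) (a b : E) :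
    g x a b = g y a b := by
  subst h
  rfl

theorem inducedMetric_congr (g : MetricField I' M') {φ φ' : M → M'} {x : M} (h : φ =ᶠ[𝓝 x] φ')
    (a b : TangentSpace I x) : inducedMetric I g φ x a b = inducedMetric I g φ' x a b := by
  unfold inducedMetric
  rw [h.mfderiv_eq]
  exact metricField_congr g h.eq_of_nhds _ _

theorem inducedMetric_comp (g : MetricField I'' M'') {f : M' → M''} {φ : M → M'} {x : M}
    (hf : MDifferentiableAt I' I'' f (φ x)) (hφ : MDifferentiableAt I I' φ x)
    (a b : TangentSpace I x) :
    inducedMetric I g (f ∘ φ) x a b =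
      inducedMetric I' g f (φ x) (mfderiv I I' φ x a) (mfderiv I I' φ x b) := by
  unfold inducedMetric
  rw [mfderiv_comp x hf hφ]
  rfl

theorem writtenInExtChartAt_extChartAt_self (φ : M → M') (p : M) :
    writtenInExtChartAt I I' p φ (extChartAt I p p) = extChartAt I' (φ p) (φ p) := by
  simp only [writtenInExtChartAt, Function.comp_apply, extChartAt_to_inv]

theorem eventually_mem_extChartAt_source {φ : M → M'} {p : M} (hφ : ContinuousAt φ p) :
    ∀ᶠ y in 𝓝 (extChartAt I p p),
      φ ((extChartAt I p).symm y) ∈ (extChartAt I' (φ p)).source := by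
  have hsymm : Tendsto (extChartAt I p).symm (𝓝 (extChartAt I p p)) (𝓝 p) := by
    simpa only [ContinuousAt, extChartAt_to_inv] using continuousAt_extChartAt_symm (I := I) p
  exact hsymm.eventually (hφ.eventually (extChartAt_source_mem_nhds (I := I') (φ p)))

variable (I I') in
/-- The differential of `φ` at `p` as a map of the model spaces, with which the tangent spaces are
identified by the preferred charts. -/
def chartDeriv (φ : M → M') (p : M) : E →L[ℝ] E' :=
  mfderiv I I' φ p

variable [I.Boundaryless]

theorem metricInChart_extChartAt_self [IsManifold I 1 M] (g : MetricField I M) (p : M) (a b : E) :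
    metricInChart g p (extChartAt I p p) a b = g p a b := by
  have h := mfderivWithin_range_extChartAt_symm (I := I) (x := p)
  rw [I.range_eq_univ, mfderivWithin_univ] at h
  unfold metricInChart
  rw [h]
  exact metricField_congr g (extChartAt_to_inv p) _ _

theorem chartDeriv_eq_fderiv_writtenInExtChartAt {φ : M → M'} {p : M}
    (hφ : MDifferentiableAt I I' φ p) :
    chartDeriv I I' φ p = fderiv ℝ (writtenInExtChartAt I I' p φ) (extChartAt I p p) := by
  rw [chartDeriv, hφ.mfderiv, I.range_eq_univ, fderivWithin_univ]

theorem contDiffAt_writtenInExtChartAt {n : ℕ∞ω} {φ : M → M'} {p : M}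
    (hφ : ContMDiffAt I I' n φ p) :
    ContDiffAt ℝ n (writtenInExtChartAt I I' p φ) (extChartAt I p p) := by
  have h := (contMDiffAt_iff.1 hφ).2
  rwa [I.range_eq_univ, contDiffWithinAt_univ] at h

theorem mdifferentiableAt_extChartAt_symm_of_mem_target [IsManifold I 1 M] {p : M} {y : E}
    (hy : y ∈ (extChartAt I p).target) :
    MDifferentiableAt 𝓘(ℝ, E) I (extChartAt I p).symm y := by
  have h := mdifferentiableWithinAt_extChartAt_symm (I := I) hy
  rwa [I.range_eq_univ, mdifferentiableWithinAt_univ] at h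

theorem eventually_metricInChart_inducedMetric [I'.Boundaryless] [IsManifold I 1 M]
    [IsManifold I' 1 M'] (g : MetricField I' M') {φ : M → M'} (hφ : ContMDiff I I' 1 φ) (p : M) :
    ∀ᶠ y in 𝓝 (extChartAt I p p), ∀ a b, metricInChart (inducedMetric I g φ) p y a b =
      metricInChart g (φ p) (writtenInExtChartAt I I' p φ y)
        (fderiv ℝ (writtenInExtChartAt I I' p φ) y a)
        (fderiv ℝ (writtenInExtChartAt I I' p φ) y b) := by
  set F := writtenInExtChartAt I I' p φ
  have hsource := eventually_mem_extChartAt_source (I := I) (I' := I') (hφ.continuous.continuousAt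
    (x := p))
  filter_upwards [(contDiffAt_writtenInExtChartAt (hφ p)).eventually (by simp),
    extChartAt_target_mem_nhds (I := I) p, hsource.eventually_nhds] with y hFy hy hsource_y a b
  have hFtarget : F y ∈ (extChartAt I' (φ p)).target :=
    (extChartAt I' (φ p)).map_source hsource_y.self_of_nhds
  have hcomp : φ ∘ (extChartAt I p).symm =ᶠ[𝓝 y] (extChartAt I' (φ p)).symm ∘ F :=
    hsource_y.mono fun z hz => ((extChartAt I' (φ p)).left_inv hz).symm
  calc metricInChart (inducedMetric I g φ) p y a b
      = inducedMetric 𝓘(ℝ, E) g (φ ∘ (extChartAt I p).symm) y a b :=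
        (inducedMetric_comp g (hφ.mdifferentiableAt one_ne_zero)
          (mdifferentiableAt_extChartAt_symm_of_mem_target hy) a b).symm
    _ = inducedMetric 𝓘(ℝ, E) g ((extChartAt I' (φ p)).symm ∘ F) y a b :=
        inducedMetric_congr g hcomp a b
    _ = inducedMetric 𝓘(ℝ, E') g (extChartAt I' (φ p)).symm (F y)
          (mfderiv 𝓘(ℝ, E) 𝓘(ℝ, E') F y a) (mfderiv 𝓘(ℝ, E) 𝓘(ℝ, E') F y b) :=
        inducedMetric_comp g (mdifferentiableAt_extChartAt_symm_of_mem_target hFtarget)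
          (hFy.differentiableAt one_ne_zero).mdifferentiableAt a b
    _ = metricInChart g (φ p) (F y) (fderiv ℝ F y a) (fderiv ℝ F y b) := by
        rw [mfderiv_eq_fderiv]
        rfl

end Charts

section LocalSections

variable {E : Type*} [NormedAddCommGroup E] [NormedSpace ℝ E]
  {E' : Type*} [NormedAddCommGroup E'] [NormedSpace ℝ E'] [FiniteDimensional ℝ E']

theorem exists_contDiffAt_rightInverse {F : E → E'} {x : E} {n : ℕ∞ω} (hn : n ≠ 0)
    (hF : ContDiffAt ℝ n F x) (hsurj : Function.Surjective (fderiv ℝ F x)) :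
    ∃ s : E' → E, ContDiffAt ℝ n s (F x) ∧ s (F x) = x ∧ ∀ᶠ y in 𝓝 (F x), F (s y) = y := by
  have := FiniteDimensional.complete ℝ E'
  obtain ⟨R, hR⟩ := (fderiv ℝ F x).exists_rightInverse_of_surjective
    (LinearMap.range_eq_top.2 hsurj)
  let line : E' → E := fun w => x + R w
  have hline : ContDiffAt ℝ n line 0 := by fun_prop
  have hline0 : line 0 = x := by simp [line]
  have hF0 : (F ∘ line) 0 = F x := congrArg F hline0
  have hcomp : ContDiffAt ℝ n (F ∘ line) 0 := (hline0.symm ▸ hF).comp 0 hline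
  have hderiv : HasFDerivAt (F ∘ line) (ContinuousLinearEquiv.refl ℝ E' : E' →L[ℝ] E') 0 := by
    have hF' : HasFDerivAt F (fderiv ℝ F x) (line 0) :=
      hline0.symm ▸ (hF.differentiableAt hn).hasFDerivAt
    have h := hF'.comp 0 (R.hasFDerivAt.const_add x)
    rwa [hR] at h
  refine ⟨line ∘ hcomp.localInverse hderiv hn, ?_, ?_, ?_⟩
  · have hinv := hcomp.to_localInverse hderiv hn
    have hline_inv : ContDiff ℝ n line := by fun_prop
    exact hF0 ▸ hline_inv.contDiffAt.comp _ hinv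
  · rw [← hF0, Function.comp_apply, hcomp.localInverse_apply_image hderiv hn, hline0]
  · exact hF0 ▸ (hcomp.hasStrictFDerivAt' hderiv hn).eventually_right_inverse

variable {H : Type*} [TopologicalSpace H] {I : ModelWithCorners ℝ E H} [I.Boundaryless]
  {H' : Type*} [TopologicalSpace H'] {I' : ModelWithCorners ℝ E' H'}
  {M : Type*} [TopologicalSpace M] [ChartedSpace H M] [IsManifold I 1 M]
  {M' : Type*} [TopologicalSpace M'] [ChartedSpace H' M'] [IsManifold I' 1 M']

theorem exists_contMDiffOn_section {φ : M → M'} {q : M} (hφ : ContMDiffAt I I' 1 φ q)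
    (hsurj : Function.Surjective (mfderiv I I' φ q)) :
    ∃ σ : M' → M, ∃ U ∈ 𝓝 (φ q), ContMDiffOn I' I 1 σ U ∧ σ (φ q) = q ∧ ∀ y ∈ U, φ (σ y) = y := by
  change Function.Surjective (chartDeriv I I' φ q) at hsurj
  rw [chartDeriv_eq_fderiv_writtenInExtChartAt (hφ.mdifferentiableAt one_ne_zero)] at hsurj
  obtain ⟨s, hs, hsq, hFs⟩ :=
    exists_contDiffAt_rightInverse one_ne_zero (contDiffAt_writtenInExtChartAt hφ) hsurj
  rw [writtenInExtChartAt_extChartAt_self] at hs hsq hFs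
  let σ : M' → M := fun y => (extChartAt I q).symm (s (extChartAt I' (φ q) y))
  have hσq : σ (φ q) = q := by simp only [σ, hsq, extChartAt_to_inv]
  have hσ : ContMDiffAt I' I 1 σ (φ q) := by
    have hs' : ContMDiffAt I' 𝓘(ℝ, E) 1 (fun y => s (extChartAt I' (φ q) y)) (φ q) :=
      hs.contMDiffAt.comp (φ q) contMDiffAt_extChartAt
    refine ContMDiffAt.comp (φ q) ?_ hs'
    rw [hsq]
    exact (contMDiffOn_extChartAt_symm q).contMDiffAt (extChartAt_target_mem_nhds q)
  have hφσ : Tendsto (φ ∘ σ) (𝓝 (φ q)) (𝓝 (φ q)) := by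
    have hφ' : ContinuousAt φ (σ (φ q)) := hσq.symm ▸ hφ.continuousAt
    simpa only [ContinuousAt, Function.comp_apply, hσq] using hφ'.comp hσ.continuousAt
  have hU : ∀ᶠ y in 𝓝 (φ q), ContMDiffAt I' I 1 σ y ∧ φ (σ y) = y := by
    filter_upwards [(contMDiffAt_iff_contMDiffAt_nhds (by simp)).1 hσ,
      (continuousAt_extChartAt (I := I') (φ q)).eventually hFs,
      extChartAt_source_mem_nhds (I := I') (φ q),
      hφσ.eventually (extChartAt_source_mem_nhds (I := I') (φ q))] with y hσy hFsy hy hφσy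
    exact ⟨hσy, (extChartAt I' (φ q)).injOn hφσy hy hFsy⟩
  exact ⟨σ, _, hU, fun y hy => hy.1.contMDiffWithinAt, hσq, fun y hy => hy.2⟩

end LocalSections

section Riemannian

variable {E : Type*} [NormedAddCommGroup E] [NormedSpace ℝ E]
  {H : Type*} [TopologicalSpace H] {I : ModelWithCorners ℝ E H} {r : ℕ∞ω}
  {M : Type*} [TopologicalSpace M] [ChartedSpace H M] [IsManifold I 1 M]

/-- A Riemannian metric, as bundled in Mathlib, seen as a field of inner products. -/
def riemMetric (gM : ContMDiffRiemannianMetric I r E (TangentSpace I : M → Type _)) :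
    MetricField I M :=
  fun x a b => gM.inner x a b

theorem isBilinearMap_riemMetric
    (gM : ContMDiffRiemannianMetric I r E (TangentSpace I : M → Type _)) (x : M) :
    IsBilinearMap ℝ (riemMetric gM x) where
  add_left a a' b := congrArg (· b) ((gM.inner x).map_add a a')
  smul_left c a b := congrArg (· b) ((gM.inner x).map_smul c a)
  add_right a b b' := (gM.inner x a).map_add b b'
  smul_right c a b := (gM.inner x a).map_smul c b

theorem riemDist_riemMetric
    (gM : ContMDiffRiemannianMetric I r E (TangentSpace I : M → Type _)) (x y : M) :
    let _ : RiemannianBundle (fun x : M => TangentSpace I x) := ⟨gM.toRiemannianMetric⟩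
    riemDist (riemMetric gM) x y = Manifold.riemannianEDist I x y := by
  let _ : RiemannianBundle (fun x : M => TangentSpace I x) := ⟨gM.toRiemannianMetric⟩
  unfold riemDist
  congr with z
  congr with a
  change ENNReal.ofReal √(gM.inner z a a) = ‖a‖ₑ
  rw [← ofReal_norm, norm_eq_sqrt_real_inner]
  rfl

theorem nhds_hasBasis_riemDist [RegularSpace M]
    (gM : ContMDiffRiemannianMetric I r E (TangentSpace I : M → Type _)) (x : M) :
    (𝓝 x).HasBasis (fun c : ℝ≥0∞ => 0 < c) fun c => {y | riemDist (riemMetric gM) y x < c} := by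
  let _ : RiemannianBundle (fun x : M => TangentSpace I x) := ⟨gM.toRiemannianMetric⟩
  have : IsContinuousRiemannianBundle E (fun x : M => TangentSpace I x) :=
    ⟨gM.inner, gM.contMDiff.continuous, fun _ _ _ => rfl⟩
  simp only [riemDist_riemMetric, Manifold.riemannianEDist_comm (y := x)]
  exact (𝓝 x).basis_sets.to_hasBasis' (fun _ hs => setOfPred_riemannianEDist_lt_subset_nhds' I hs)
    fun _ hc => eventually_riemannianEDist_lt I x hc

theorem tendsto_nhds_iff_riemDist [RegularSpace M]
    (gM : ContMDiffRiemannianMetric I r E (TangentSpace I : M → Type _)) {ι : Type*} {l : Filter ι}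
    {s : ι → M} {x : M} :
    Tendsto s l (𝓝 x) ↔ Tendsto (fun i => riemDist (riemMetric gM) (s i) x) l (𝓝 0) := by
  simp only [(nhds_hasBasis_riemDist gM x).tendsto_right_iff,
    ENNReal.nhds_zero_basis.tendsto_right_iff, mem_ofPred_eq, mem_Iio]

theorem riemDist_lt_top [RegularSpace M] [PreconnectedSpace M]
    (gM : ContMDiffRiemannianMetric I r E (TangentSpace I : M → Type _)) (x y : M) :
    riemDist (riemMetric gM) x y < ⊤ := by
  let d := riemPseudoEMetricSpace (isBilinearMap_riemMetric gM)
  refine PreconnectedSpace.induction₂' (fun x y => d.edist x y < ⊤) (fun x => ?_)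
    ⟨fun x y z hxy hyz => ?_⟩ x y
  · filter_upwards [(nhds_hasBasis_riemDist gM x).mem_of_mem ENNReal.zero_lt_top] with y hy
    exact ⟨(d.edist_comm x y).trans_lt hy, hy⟩
  · exact (d.edist_triangle x y z).trans_lt (ENNReal.add_lt_top.2 ⟨hxy, hyz⟩)

section Lift

variable {E' : Type*} [NormedAddCommGroup E'] [NormedSpace ℝ E']
  {H' : Type*} [TopologicalSpace H'] {I' : ModelWithCorners ℝ E' H'}
  {S : Type*} [TopologicalSpace S] [ChartedSpace H' S]
  {g : MetricField I M} {φ : S → M}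

theorem exists_lift_Icc [FiniteDimensional ℝ E] [I'.Boundaryless] [IsManifold I' 1 S]
    (hg : ∀ x, IsBilinearMap ℝ (g x)) (hφ : ContMDiff I' I 1 φ)
    (hsurj : ∀ p, Function.Surjective (mfderiv I' I φ p)) {γ : ℝ → M} {t b : ℝ}
    (hγ : ContMDiffOn 𝓘(ℝ, ℝ) I 1 γ (Icc t b)) (htb : t < b) {q : S} (hq : φ q = γ t) :
    ∃ t' ∈ Ioc t b, ∃ q', φ q' = γ t' ∧
      riemDist (inducedMetric I' g φ) q q' ≤ metricLength g γ t t' := by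
  obtain ⟨σ, U, hU, hσ, hσq, hφσ⟩ := exists_contMDiffOn_section (hφ q) (hsurj q)
  rw [hq] at hU hσq
  have hγt : Tendsto γ (𝓝[≥] t) (𝓝 (γ t)) := by
    rw [← nhdsWithin_Icc_eq_nhdsGE htb]
    exact hγ.continuousOn t (left_mem_Icc.2 htb.le)
  obtain ⟨t₁, ht₁, hγU⟩ := mem_nhdsGE_iff_exists_Icc_subset.1 (hγt hU)
  let t' := min t₁ b
  have htt' : t < t' := lt_min ht₁ htb
  have hγU' : MapsTo γ (Icc t t') U := fun s hs => hγU ⟨hs.1, hs.2.trans (min_le_left _ _)⟩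
  have hσγ : ContMDiffOn 𝓘(ℝ, ℝ) I' 1 (σ ∘ γ) (Icc t t') :=
    hσ.comp (hγ.mono (Icc_subset_Icc_right (min_le_right _ _))) hγU'
  refine ⟨t', ⟨htt', min_le_right _ _⟩, σ (γ t'), hφσ _ (hγU' (right_mem_Icc.2 htt'.le)), ?_⟩
  calc riemDist (inducedMetric I' g φ) q (σ (γ t'))
      = riemDist (inducedMetric I' g φ) ((σ ∘ γ) t) ((σ ∘ γ) t') := by
        rw [Function.comp_apply, hσq, Function.comp_apply]
    _ ≤ metricLength (inducedMetric I' g φ) (σ ∘ γ) t t' :=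
        riemDist_le_metricLength (isBilinearMap_inducedMetric hg φ) htt'.le hσγ
    _ = metricLength g (φ ∘ σ ∘ γ) t t' :=
        (metricLength_comp g (hφ.mdifferentiable one_ne_zero) hσγ).symm
    _ = metricLength g γ t t' := metricLength_congr g fun s hs => hφσ _ (hγU' hs)

variable [FiniteDimensional ℝ E] [I'.Boundaryless] [IsManifold I' 1 S] [T3Space M]
  {gM : ContMDiffRiemannianMetric I r E (TangentSpace I : M → Type _)}

theorem exists_lift_endpoint (hφ : ContMDiff I' I 1 φ)
    (hsurj : ∀ p, Function.Surjective (mfderiv I' I φ p))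
    (hcomp : IsCompleteMetric (inducedMetric I' (riemMetric gM) φ)) {γ : ℝ → M} {a b : ℝ}
    (hab : a ≤ b) (hγ : ContMDiffOn 𝓘(ℝ, ℝ) I 1 γ (Icc a b))
    (hfin : metricLength (riemMetric gM) γ a b ≠ ⊤) {p : S} (hp : φ p = γ a) :
    ∃ q, φ q = γ b ∧ riemDist (inducedMetric I' (riemMetric gM) φ) p q ≤
      metricLength (riemMetric gM) γ a b := by
  have hgM := isBilinearMap_riemMetric gM
  let L := metricLength (riemMetric gM) γ
  have hL {s t : ℝ} (hs : a ≤ s) (ht : t ≤ b) : L s t ≠ ⊤ :=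
    ne_top_of_le_ne_top hfin (metricLength_mono _ γ hs ht)
  have hL_add {s t : ℝ} (hs : a ≤ s) (hst : s ≤ t) (ht : t ≤ b) :
      (L a s).toReal + (L s t).toReal = (L a t).toReal := by
    rw [← ENNReal.toReal_add (hL le_rfl (hst.trans ht)) (hL hs ht)]
    exact congrArg ENNReal.toReal (metricLength_add _ γ hs hst)
  have hL_sub {s t : ℝ} (hs : a ≤ s) (hst : s ≤ t) (ht : t ≤ b) :
      ENNReal.ofReal ((L a t).toReal - (L a s).toReal) = L s t := by
    rw [← hL_add hs hst ht, add_sub_cancel_left, ENNReal.ofReal_toReal (hL hs ht)]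
  let d := riemPseudoEMetricSpace (isBilinearMap_inducedMetric (I := I') hgM φ)
  have hφ_cont : @Continuous S M d.toUniformSpace.toTopologicalSpace _ φ := by
    refine @continuous_iff_continuousAt S M d.toUniformSpace.toTopologicalSpace _ φ |>.2 fun q => ?_
    refine (tendsto_nhds_iff_riemDist gM).2 (tendsto_of_tendsto_of_tendsto_of_le_of_le
      tendsto_const_nhds (tendsto_iff_edist_tendsto_0.1 tendsto_id) (fun _ => zero_le)
      fun p => riemDist_apply_le hgM hφ p q)
  have hstep : ∀ t ∈ Ico a b, ∀ q, φ q = γ t → ∃ t' ∈ Ioc t b, ∃ q', φ q' = γ t' ∧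
      d.edist q q' ≤ ENNReal.ofReal ((L a t').toReal - (L a t).toReal) := fun t ht q hq => by
    obtain ⟨t', ht', q', hq', hd⟩ :=
      exists_lift_Icc hgM hφ hsurj (hγ.mono (Icc_subset_Icc_left ht.1)) ht.2 hq
    exact ⟨t', ht', q', hq', hd.trans_eq (hL_sub ht.1 ht'.1.le ht'.2).symm⟩
  have hmono : MonotoneOn (fun t => (L a t).toReal) (Icc a b) := fun s _ t ht hst =>
    ENNReal.toReal_mono (hL le_rfl ht.2) (metricLength_mono _ γ le_rfl hst)
  obtain ⟨q, hq, hpq⟩ := @exists_lift_of_forall_exists_gt S M d ((isCompleteMetric_iff _).1 hcomp)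
    _ _ φ hφ_cont γ a b hab hγ.continuousOn _ hmono hstep p hp
  exact ⟨q, hq, hpq.trans_eq (hL_sub le_rfl hab le_rfl)⟩

theorem exists_lift_of_riemDist_lt (hφ : ContMDiff I' I 1 φ)
    (hsurj : ∀ p, Function.Surjective (mfderiv I' I φ p))
    (hcomp : IsCompleteMetric (inducedMetric I' (riemMetric gM) φ)) {p : S} {y : M} {c : ℝ≥0∞}
    (h : riemDist (riemMetric gM) (φ p) y < c) :
    ∃ q, φ q = y ∧ riemDist (inducedMetric I' (riemMetric gM) φ) p q < c := by
  obtain ⟨γ, hγ0, rfl, hγ, hlt⟩ := exists_metricLength_lt_of_riemDist_lt h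
  obtain ⟨q, hq, hd⟩ := exists_lift_endpoint hφ hsurj hcomp zero_le_one hγ hlt.ne_top hγ0.symm
  exact ⟨q, hq, hd.trans_lt hlt⟩

theorem surjective_of_isCompleteMetric [PreconnectedSpace M] [Nonempty S]
    (hφ : ContMDiff I' I 1 φ) (hsurj : ∀ p, Function.Surjective (mfderiv I' I φ p))
    (hcomp : IsCompleteMetric (inducedMetric I' (riemMetric gM) φ)) : Function.Surjective φ :=
  fun y => (exists_lift_of_riemDist_lt hφ hsurj hcomp
    (riemDist_lt_top gM (φ (Classical.arbitrary S)) y)).imp fun _ hq => hq.1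

theorem isCompleteMetric_of_surjective (hφ : ContMDiff I' I 1 φ)
    (hsurj : ∀ p, Function.Surjective (mfderiv I' I φ p)) (hφsurj : Function.Surjective φ)
    (hcomp : IsCompleteMetric (inducedMetric I' (riemMetric gM) φ)) :
    IsCompleteMetric (riemMetric gM) := by
  have hgM := isBilinearMap_riemMetric gM
  let dS := riemPseudoEMetricSpace (isBilinearMap_inducedMetric (I := I') hgM φ)
  let dM := riemPseudoEMetricSpace hgM
  have hLip : LipschitzWith 1 φ := fun p q =>
    (riemDist_apply_le hgM hφ p q).trans_eq (one_mul (edist p q)).symm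
  have := (isCompleteMetric_iff (isBilinearMap_inducedMetric (I := I') hgM φ)).1 hcomp
  exact (isCompleteMetric_iff hgM).2 (completeSpace_of_surjective_of_lift hLip hφsurj
    fun p y c h => exists_lift_of_riemDist_lt hφ hsurj hcomp h)

end Lift

end Riemannian

section ScalarProducts

variable {E : Type*} [NormedAddCommGroup E] [NormedSpace ℝ E]
  {E' : Type*} [NormedAddCommGroup E'] [NormedSpace ℝ E']

/-- A scalar product: a nondegenerate symmetric bilinear form, not necessarily definite. -/
structure IsScalarProduct (B : E → E → ℝ) : Prop where
  isBilinearMap : IsBilinearMap ℝ B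
  symm : ∀ a b, B a b = B b a
  eq_zero_of_apply_eq_zero : ∀ a, (∀ b, B a b = 0) → a = 0

theorem IsScalarProduct.eq_of_apply_eq {B : E → E → ℝ} (hB : IsScalarProduct B) {v w : E}
    (h : ∀ c, B c v = B c w) : v = w := by
  refine sub_eq_zero.1 (hB.eq_zero_of_apply_eq_zero _ fun c => ?_)
  have hsub := (hB.isBilinearMap.toLinearMap c).map_sub v w
  rw [hB.symm]
  exact hsub.trans (sub_eq_zero.2 (h c))

theorem IsScalarProduct.comp {B : E' → E' → ℝ} (hB : IsScalarProduct B) (A : E ≃ₗ[ℝ] E') :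
    IsScalarProduct fun a b => B (A a) (A b) where
  isBilinearMap :=
    { add_left := fun _ _ _ => by rw [map_add, hB.isBilinearMap.add_left]
      smul_left := fun _ _ _ => by rw [map_smul, hB.isBilinearMap.smul_left]
      add_right := fun _ _ _ => by rw [map_add, hB.isBilinearMap.add_right]
      smul_right := fun _ _ _ => by rw [map_smul, hB.isBilinearMap.smul_right] }
  symm a b := hB.symm (A a) (A b)
  eq_zero_of_apply_eq_zero a ha := A.map_eq_zero_iff.1 <|
    hB.eq_zero_of_apply_eq_zero (A a) fun b => by
      simpa only [A.apply_symm_apply] using ha (A.symm b)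

variable [FiniteDimensional ℝ E] [FiniteDimensional ℝ E']

/-- The vector representing the linear form `l` with respect to the scalar product `B`. -/
def sharp (B : E → E → ℝ) (l : E → ℝ) : E :=
  ∑ i, ∑ j, (invGram B i j * l (Module.finBasis ℝ E j)) • Module.finBasis ℝ E i

theorem isUnit_det_gram {B : E → E → ℝ} (hB : IsScalarProduct B) :
    IsUnit (Matrix.of fun i j => B (Module.finBasis ℝ E i) (Module.finBasis ℝ E j)).det := by
  have hgram : (Matrix.of fun i j => B (Module.finBasis ℝ E i) (Module.finBasis ℝ E j)) =
      LinearMap.toMatrix₂ (Module.finBasis ℝ E) (Module.finBasis ℝ E)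
        hB.isBilinearMap.toLinearMap := by
    ext i j
    rw [LinearMap.toMatrix₂_apply]
    rfl
  rw [hgram, isUnit_iff_ne_zero, ← LinearMap.separatingLeft_iff_det_ne_zero]
  exact hB.eq_zero_of_apply_eq_zero

theorem apply_sharp {B : E → E → ℝ} (hB : IsScalarProduct B) {l : E → ℝ} (hl : IsLinearMap ℝ l)
    (c : E) : B c (sharp B l) = l c := by
  let B' := hB.isBilinearMap.toLinearMap
  suffices h : B'.flip (sharp B l) = IsLinearMap.mk' l hl from LinearMap.congr_fun h c
  refine (Module.finBasis ℝ E).ext fun k => ?_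
  set G := Matrix.of fun i j => B (Module.finBasis ℝ E i) (Module.finBasis ℝ E j)
  calc B' (Module.finBasis ℝ E k) (sharp B l)
      = ∑ i, ∑ j, G⁻¹ i j * l (Module.finBasis ℝ E j) * G k i := by
        simp only [sharp, map_sum, map_smul, smul_eq_mul]
        rfl
    _ = ∑ j, (G * G⁻¹) k j * l (Module.finBasis ℝ E j) := by
        rw [Finset.sum_comm]
        simp only [Matrix.mul_apply, Finset.sum_mul]
        exact Finset.sum_congr rfl fun j _ => Finset.sum_congr rfl fun i _ => by ring
    _ = l (Module.finBasis ℝ E k) := by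
        simp [Matrix.mul_nonsing_inv G (isUnit_det_gram hB), Matrix.one_apply]

theorem metricTrace_eq_trace {B S : E → E → ℝ} (hB : IsScalarProduct B) {T : E →ₗ[ℝ] E}
    (hT : ∀ a c, B c (T a) = S a c) : metricTrace B S = LinearMap.trace ℝ E T := by
  have hS (a : E) : IsLinearMap ℝ (S a) := by
    rw [← funext (hT a)]
    exact (hB.isBilinearMap.toLinearMap.flip (T a)).isLinear
  have hTsharp (a : E) : T a = sharp B (S a) :=
    hB.eq_of_apply_eq fun c => (hT a c).trans (apply_sharp hB (hS a) c).symm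
  rw [LinearMap.trace_eq_matrix_trace ℝ (Module.finBasis ℝ E), Matrix.trace]
  refine Finset.sum_congr rfl fun i _ => ?_
  simp [LinearMap.toMatrix_apply, hTsharp, sharp, ← Finset.sum_smul, Finsupp.single_apply]

theorem exists_linearMap_apply_eq {B S : E → E → ℝ} (hB : IsScalarProduct B)
    (hS : IsBilinearMap ℝ S) : ∃ T : E →ₗ[ℝ] E, ∀ a c, B c (T a) = S a c := by
  have hsharp (a c : E) : B c (sharp B (S a)) = S a c :=
    apply_sharp hB (hS.toLinearMap a).isLinear c
  refine ⟨⟨⟨fun a => sharp B (S a), fun a a' => ?_⟩, fun r a => ?_⟩, hsharp⟩ <;>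
    refine hB.eq_of_apply_eq fun c => ?_
  · rw [hB.isBilinearMap.add_right, hsharp, hsharp, hsharp, hS.add_left]
  · rw [RingHom.id_apply, hB.isBilinearMap.smul_right, hsharp, hsharp, hS.smul_left]

theorem metricTrace_comp {B S : E' → E' → ℝ} (hB : IsScalarProduct B) (hS : IsBilinearMap ℝ S)
    (A : E ≃ₗ[ℝ] E') :
    metricTrace (fun a b => B (A a) (A b)) (fun a b => S (A a) (A b)) = metricTrace B S := by
  obtain ⟨T, hT⟩ := exists_linearMap_apply_eq hB hS
  rw [metricTrace_eq_trace hB hT, ← LinearMap.trace_conj' T A.symm]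
  refine metricTrace_eq_trace (hB.comp A) fun a c => ?_
  simpa using hT (A a) (A c)

theorem map_metricTrace {F : Type*} [AddCommGroup F] [Module ℝ F] (l : F →ₗ[ℝ] ℝ)
    (B : E → E → ℝ) (S : E → E → F) :
    l (metricTrace B S) = metricTrace B fun a b => l (S a b) := by
  simp only [metricTrace, map_sum, map_smul]

end ScalarProducts

theorem differentiableAt_clm_apply_iff {D E F : Type*} [NormedAddCommGroup D] [NormedSpace ℝ D]
    [NormedAddCommGroup E] [NormedSpace ℝ E] [FiniteDimensional ℝ E] [NormedAddCommGroup F]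
    [NormedSpace ℝ F] {f : D → E →L[ℝ] F} {x : D} :
    DifferentiableAt ℝ f x ↔ ∀ a, DifferentiableAt ℝ (fun y => f y a) x := by
  refine ⟨fun h a => h.clm_apply (differentiableAt_const a), fun h => ?_⟩
  let e₁ := ContinuousLinearEquiv.ofFinrankEq
    (Module.finrank_fin_fun (n := Module.finrank ℝ E) ℝ).symm
  let e₂ := (e₁.arrowCongr (1 : F ≃L[ℝ] F)).trans (ContinuousLinearEquiv.piRing _)
  exact e₂.comp_differentiableAt_iff.1 (differentiableAt_pi.2 fun i => h _)

section SemiRiemannian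

variable {E : Type*} [NormedAddCommGroup E] [NormedSpace ℝ E] [FiniteDimensional ℝ E]
  {H : Type*} [TopologicalSpace H] {I : ModelWithCorners ℝ E H}
  {M : Type*} [TopologicalSpace M] [ChartedSpace H M]
  {g : MetricField I M}

/-- A semi-Riemannian metric which is just regular enough to have Christoffel symbols: at every
point, its components in the preferred chart there are differentiable. -/
structure IsSemiRiemannian (g : MetricField I M) : Prop where
  isScalarProduct : ∀ x, IsScalarProduct (E := E) (g x)
  differentiableAt : ∀ p a b,
    DifferentiableAt ℝ (fun y => metricInChart g p y a b) (extChartAt I p p)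

namespace IsSemiRiemannian

/-- The metric at `p`, as a bounded bilinear form on the model space. -/
def form (hg : IsSemiRiemannian g) (p : M) : E →L[ℝ] E →L[ℝ] ℝ :=
  (hg.isScalarProduct p).isBilinearMap.toContinuousBilinearMap

theorem eq_of_form_eq (hg : IsSemiRiemannian g) {p : M} {v w : E}
    (h : ∀ c, hg.form p c v = hg.form p c w) : v = w :=
  (hg.isScalarProduct p).eq_of_apply_eq h

/-- The metric in the preferred chart at `p`, as a field of bounded bilinear forms. -/
def chartForm (hg : IsSemiRiemannian g) (p : M) (y : E) : E →L[ℝ] E →L[ℝ] ℝ :=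
  IsBilinearMap.toContinuousBilinearMap (f := metricInChart g p y) <|
    isBilinearMap_inducedMetric (I := 𝓘(ℝ, E)) (fun x => (hg.isScalarProduct x).isBilinearMap)
      (extChartAt I p).symm y

theorem differentiableAt_chartForm (hg : IsSemiRiemannian g) (p : M) :
    DifferentiableAt ℝ (hg.chartForm p) (extChartAt I p p) :=
  differentiableAt_clm_apply_iff.2 fun a => differentiableAt_clm_apply_iff.2 fun b =>
    hg.differentiableAt p a b

set_option synthInstance.maxHeartbeats 200000 in
-- Instance search on nested spaces of bounded multilinear maps is slow.
/-- The first derivatives `(a, b, c) ↦ ∂_a g(b, c)` of the components of the metric in the preferred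
chart at `p`. -/
def formDeriv (hg : IsSemiRiemannian g) (p : M) : E →L[ℝ] E →L[ℝ] E →L[ℝ] ℝ :=
  fderiv ℝ (hg.chartForm p) (extChartAt I p p)

theorem fderiv_metricInChart (hg : IsSemiRiemannian g) (p : M) (a b c : E) :
    fderiv ℝ (fun y => metricInChart g p y b c) (extChartAt I p p) a = hg.formDeriv p a b c := by
  have h := ((hg.differentiableAt_chartForm p).hasFDerivAt.clm_apply
    (hasFDerivAt_const b _)).clm_apply (hasFDerivAt_const c _)
  refine (congrArg (· a) h.fderiv).trans ?_
  simp [formDeriv]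

theorem form_comm (hg : IsSemiRiemannian g) (x : M) (a b : E) :
    hg.form x a b = hg.form x b a :=
  (hg.isScalarProduct x).symm a b

theorem christoffelFirst_eq (hg : IsSemiRiemannian g) (p : M) (a b c : E) :
    christoffelFirst g p a b c =
      (hg.formDeriv p a b c + hg.formDeriv p b a c - hg.formDeriv p c a b) / 2 := by
  simp only [christoffelFirst, hg.fderiv_metricInChart]

theorem isLinearMap_christoffelFirst (hg : IsSemiRiemannian g) (p : M) (a b : E) :
    IsLinearMap ℝ (christoffelFirst g p a b) where
  map_add c c' := by
    simp only [hg.christoffelFirst_eq, ContinuousLinearMap.map_add, add_apply]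
    ring
  map_smul r c := by
    simp only [hg.christoffelFirst_eq, ContinuousLinearMap.map_smul, smul_apply, smul_eq_mul]
    ring

variable [I.Boundaryless] [IsManifold I 1 M]

theorem chartForm_extChartAt_self (hg : IsSemiRiemannian g) (p : M) :
    hg.chartForm p (extChartAt I p p) = hg.form p := by
  ext a b
  exact metricInChart_extChartAt_self g p a b

theorem form_christoffel (hg : IsSemiRiemannian g) (p : M) (a b c : E) :
    hg.form p c (christoffel g p a b) = christoffelFirst g p a b c := by
  have hchart : metricInChart g p (extChartAt I p p) = fun a b => hg.form p a b := by
    funext a b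
    exact metricInChart_extChartAt_self g p a b
  unfold christoffel
  rw [hchart]
  exact apply_sharp (hg.isScalarProduct p) (hg.isLinearMap_christoffelFirst p a b) c

theorem isBilinearMap_christoffel (hg : IsSemiRiemannian g) (p : M) :
    IsBilinearMap ℝ (christoffel g p : E → E → E) := by
  have hfirst (a b c : E) : hg.form p c (christoffel g p a b) =
      (hg.formDeriv p a b c + hg.formDeriv p b a c - hg.formDeriv p c a b) / 2 :=
    (hg.form_christoffel p a b c).trans (hg.christoffelFirst_eq p a b c)
  refine ⟨fun a a' b => ?_, fun r a b => ?_, fun a b b' => ?_, fun r a b => ?_⟩ <;>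
    refine hg.eq_of_form_eq (p := p) fun c => ?_ <;>
    simp only [hfirst, ContinuousLinearMap.map_add, ContinuousLinearMap.map_smul, add_apply,
      smul_apply, smul_eq_mul] <;>
    ring

end IsSemiRiemannian

end SemiRiemannian

section SecondDerivatives

variable {E : Type*} [NormedAddCommGroup E] [NormedSpace ℝ E]
  {H : Type*} [TopologicalSpace H] {I : ModelWithCorners ℝ E H}
  {E' : Type*} [NormedAddCommGroup E'] [NormedSpace ℝ E']
  {H' : Type*} [TopologicalSpace H'] {I' : ModelWithCorners ℝ E' H'}
  {M : Type*} [TopologicalSpace M] [ChartedSpace H M]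
  {M' : Type*} [TopologicalSpace M'] [ChartedSpace H' M']
  {E'' : Type*} [NormedAddCommGroup E''] [NormedSpace ℝ E'']
  {H'' : Type*} [TopologicalSpace H''] {I'' : ModelWithCorners ℝ E'' H''}
  {M'' : Type*} [TopologicalSpace M''] [ChartedSpace H'' M'']
  {φ : M → M'} {p : M}

theorem writtenInExtChartAt_comp_eventuallyEq {f : M' → M''} (hφ : ContinuousAt φ p) :
    writtenInExtChartAt I I'' p (f ∘ φ) =ᶠ[𝓝 (extChartAt I p p)]
      writtenInExtChartAt I' I'' (φ p) f ∘ writtenInExtChartAt I I' p φ := by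
  filter_upwards [eventually_mem_extChartAt_source (I := I) (I' := I') hφ] with y hy
  simp only [writtenInExtChartAt, Function.comp_apply, (extChartAt I' (φ p)).left_inv hy]

variable [I.Boundaryless]

theorem differentiableAt_fderiv_writtenInExtChartAt (hφ : ContMDiffAt I I' 2 φ p) :
    DifferentiableAt ℝ (fderiv ℝ (writtenInExtChartAt I I' p φ)) (extChartAt I p p) :=
  ((contDiffAt_writtenInExtChartAt hφ).fderiv_right (m := 1) (by norm_num)).differentiableAt
    one_ne_zero

theorem secondDerivInChart_eq (hφ : ContMDiffAt I I' 2 φ p) (a b : E) :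
    secondDerivInChart I I' φ p a b =
      fderiv ℝ (fderiv ℝ (writtenInExtChartAt I I' p φ)) (extChartAt I p p) a b := by
  unfold secondDerivInChart
  rw [((differentiableAt_fderiv_writtenInExtChartAt hφ).hasFDerivAt.clm_apply
    (hasFDerivAt_const b _)).fderiv]
  simp

theorem secondDerivInChart_comm (hφ : ContMDiffAt I I' 2 φ p) (a b : E) :
    secondDerivInChart I I' φ p a b = secondDerivInChart I I' φ p b a := by
  rw [secondDerivInChart_eq hφ, secondDerivInChart_eq hφ]
  exact (contDiffAt_writtenInExtChartAt hφ).isSymmSndFDerivAt (by simp) a b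

theorem isBilinearMap_secondDerivInChart (hφ : ContMDiffAt I I' 2 φ p) :
    IsBilinearMap ℝ (secondDerivInChart I I' φ p) := by
  refine ⟨?_, ?_, ?_, ?_⟩ <;> intro _ _ _ <;>
    simp only [secondDerivInChart_eq hφ, map_add, map_smul, add_apply, smul_apply]

theorem secondDerivInChart_comp [I'.Boundaryless] {f : M' → M''}
    (hf : ContMDiffAt I' I'' 2 f (φ p)) (hφ : ContMDiffAt I I' 2 φ p) (a b : E) :
    secondDerivInChart I I'' (f ∘ φ) p a b =
      secondDerivInChart I' I'' f (φ p) (chartDeriv I I' φ p a) (chartDeriv I I' φ p b)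
        + chartDeriv I' I'' f (φ p) (secondDerivInChart I I' φ p a b) := by
  rw [secondDerivInChart_eq (hf.comp p hφ), secondDerivInChart_eq hf, secondDerivInChart_eq hφ,
    chartDeriv_eq_fderiv_writtenInExtChartAt (hφ.mdifferentiableAt two_ne_zero),
    chartDeriv_eq_fderiv_writtenInExtChartAt (hf.mdifferentiableAt two_ne_zero)]
  set Φ := writtenInExtChartAt I I' p φ
  set F := writtenInExtChartAt I' I'' (φ p) f
  set y := extChartAt I p p
  have hΦy : Φ y = extChartAt I' (φ p) (φ p) := writtenInExtChartAt_extChartAt_self φ p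
  have hΦ : ContDiffAt ℝ 2 Φ y := contDiffAt_writtenInExtChartAt hφ
  have hF : ContDiffAt ℝ 2 F (Φ y) := hΦy ▸ contDiffAt_writtenInExtChartAt hf
  have hF' : HasFDerivAt (fderiv ℝ F) (fderiv ℝ (fderiv ℝ F) (Φ y)) (Φ y) :=
    (hΦy ▸ differentiableAt_fderiv_writtenInExtChartAt hf).hasFDerivAt
  have hchain : fderiv ℝ (writtenInExtChartAt I I'' p (f ∘ φ)) =ᶠ[𝓝 y]
      fun w => (fderiv ℝ F (Φ w)).comp (fderiv ℝ Φ w) := by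
    filter_upwards [(writtenInExtChartAt_comp_eventuallyEq (I := I) (I' := I') (I'' := I'')
      (f := f) hφ.continuousAt).eventuallyEq_nhds, hΦ.eventually (by simp),
      hΦ.continuousAt.eventually (hF.eventually (by simp))] with w hw hΦw hFw
    rw [hw.fderiv_eq]
    exact fderiv_comp w (hFw.differentiableAt two_ne_zero) (hΦw.differentiableAt two_ne_zero)
  have hD := (hF'.comp y (hΦ.differentiableAt two_ne_zero).hasFDerivAt).clm_comp
    (differentiableAt_fderiv_writtenInExtChartAt hφ).hasFDerivAt
  rw [hchain.fderiv_eq, show fderiv ℝ (fun w => (fderiv ℝ F (Φ w)).comp (fderiv ℝ Φ w)) y = _ from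
    hD.fderiv, ← hΦy]
  exact add_comm _ _

theorem hessian_comp [FiniteDimensional ℝ E] [FiniteDimensional ℝ E'] [I'.Boundaryless]
    (g : MetricField I' M') {f : M' → ℝ} (hf : ContMDiffAt I' 𝓘(ℝ, ℝ) 2 f (φ p))
    (hφ : ContMDiffAt I I' 2 φ p) (a b : E) :
    hessian (inducedMetric I g φ) (f ∘ φ) p a b =
      hessian g f (φ p) (chartDeriv I I' φ p a) (chartDeriv I I' φ p b)
        + chartDeriv I' 𝓘(ℝ, ℝ) f (φ p) (secondFundamentalForm I g φ p a b) := by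
  set A := chartDeriv I I' φ p
  set df := chartDeriv I' 𝓘(ℝ, ℝ) f (φ p)
  set Γ : E := christoffel (inducedMetric I g φ) p a b
  set Γ' : E' := christoffel g (φ p) (A a) (A b)
  have hchain : chartDeriv I 𝓘(ℝ, ℝ) (f ∘ φ) p Γ = df (A Γ) :=
    congrArg (· Γ) (mfderiv_comp p (hf.mdifferentiableAt two_ne_zero)
      (hφ.mdifferentiableAt two_ne_zero))
  calc hessian (inducedMetric I g φ) (f ∘ φ) p a b
      = secondDerivInChart I 𝓘(ℝ, ℝ) (f ∘ φ) p a b - chartDeriv I 𝓘(ℝ, ℝ) (f ∘ φ) p Γ := rfl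
    _ = (secondDerivInChart I' 𝓘(ℝ, ℝ) f (φ p) (A a) (A b) - df Γ')
          + df (secondDerivInChart I I' φ p a b + Γ' - A Γ) := by
        rw [secondDerivInChart_comp hf hφ, hchain, map_sub, map_add]
        ring

end SecondDerivatives

set_option synthInstance.maxHeartbeats 200000 in
-- Again slow instances on nested multilinear maps.
theorem exists_hasFDerivAt_bilinear_fderiv {E E' : Type*} [NormedAddCommGroup E]
    [NormedSpace ℝ E] [NormedAddCommGroup E'] [NormedSpace ℝ E'] {F : E → E'} {y : E}
    (hF : ContDiffAt ℝ 2 F y) {G : E' → E' →L[ℝ] E' →L[ℝ] ℝ}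
    {G' : E' →L[ℝ] E' →L[ℝ] E' →L[ℝ] ℝ} (hG : HasFDerivAt G G' (F y)) (b c : E) :
    ∃ L : E →L[ℝ] ℝ, HasFDerivAt (fun w => G (F w) (fderiv ℝ F w b) (fderiv ℝ F w c)) L y ∧
      ∀ a, L a = G' (fderiv ℝ F y a) (fderiv ℝ F y b) (fderiv ℝ F y c)
        + G (F y) (fderiv ℝ (fderiv ℝ F) y a b) (fderiv ℝ F y c)
        + G (F y) (fderiv ℝ F y b) (fderiv ℝ (fderiv ℝ F) y a c) := by
  have hF1 : HasFDerivAt F (fderiv ℝ F y) y := (hF.differentiableAt two_ne_zero).hasFDerivAt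
  have hF2 : HasFDerivAt (fderiv ℝ F) (fderiv ℝ (fderiv ℝ F) y) y :=
    ((hF.fderiv_right (m := 1) (by norm_num)).differentiableAt one_ne_zero).hasFDerivAt
  have hF' (b : E) := hF2.clm_apply (hasFDerivAt_const b y)
  refine ⟨_, ((hG.comp y hF1).clm_apply (hF' b)).clm_apply (hF' c), fun a => ?_⟩
  simp only [add_apply, ContinuousLinearMap.comp_apply, ContinuousLinearMap.flip_apply,
    zero_apply, map_zero, zero_add]
  ring

section InducedMetrics

variable {E : Type*} [NormedAddCommGroup E] [NormedSpace ℝ E]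
  {H : Type*} [TopologicalSpace H] {I : ModelWithCorners ℝ E H} [I.Boundaryless]
  {E' : Type*} [NormedAddCommGroup E'] [NormedSpace ℝ E'] [FiniteDimensional ℝ E']
  {H' : Type*} [TopologicalSpace H'] {I' : ModelWithCorners ℝ E' H'} [I'.Boundaryless]
  {M : Type*} [TopologicalSpace M] [ChartedSpace H M] [IsManifold I 1 M]
  {M' : Type*} [TopologicalSpace M'] [ChartedSpace H' M'] [IsManifold I' 1 M']
  {g : MetricField I' M'} {φ : M → M'}

namespace IsSemiRiemannian

theorem exists_hasFDerivAt_metricInChart_inducedMetric (hg : IsSemiRiemannian g)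
    (hφ : ContMDiff I I' 2 φ) (p : M) (b c : E) :
    ∃ L : E →L[ℝ] ℝ,
      HasFDerivAt (fun y => metricInChart (inducedMetric I g φ) p y b c) L (extChartAt I p p) ∧
      ∀ a, L a = hg.formDeriv (φ p) (chartDeriv I I' φ p a) (chartDeriv I I' φ p b)
          (chartDeriv I I' φ p c)
        + hg.form (φ p) (secondDerivInChart I I' φ p a b) (chartDeriv I I' φ p c)
        + hg.form (φ p) (chartDeriv I I' φ p b) (secondDerivInChart I I' φ p a c) := by
  have hself : writtenInExtChartAt I I' p φ (extChartAt I p p) = extChartAt I' (φ p) (φ p) :=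
    writtenInExtChartAt_extChartAt_self φ p
  obtain ⟨L, hL, hLa⟩ := exists_hasFDerivAt_bilinear_fderiv
    (contDiffAt_writtenInExtChartAt (hφ p))
    (hself ▸ (hg.differentiableAt_chartForm (φ p)).hasFDerivAt) b c
  refine ⟨L, hL.congr_of_eventuallyEq ?_, fun a => ?_⟩
  · exact (eventually_metricInChart_inducedMetric g (hφ.of_le one_le_two) p).mono
      fun y hy => hy b c
  · rw [hLa, hself, hg.chartForm_extChartAt_self, secondDerivInChart_eq (hφ p),
      secondDerivInChart_eq (hφ p),
      chartDeriv_eq_fderiv_writtenInExtChartAt (hφ.mdifferentiableAt two_ne_zero)]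
    rfl

theorem fderiv_metricInChart_inducedMetric (hg : IsSemiRiemannian g) (hφ : ContMDiff I I' 2 φ)
    (p : M) (a b c : E) :
    fderiv ℝ (fun y => metricInChart (inducedMetric I g φ) p y b c) (extChartAt I p p) a =
      hg.formDeriv (φ p) (chartDeriv I I' φ p a) (chartDeriv I I' φ p b) (chartDeriv I I' φ p c)
        + hg.form (φ p) (secondDerivInChart I I' φ p a b) (chartDeriv I I' φ p c)
        + hg.form (φ p) (chartDeriv I I' φ p b) (secondDerivInChart I I' φ p a c) := by
  obtain ⟨_, hL, hLa⟩ := hg.exists_hasFDerivAt_metricInChart_inducedMetric hφ p b c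
  rw [hL.fderiv, hLa]

protected theorem inducedMetric (hg : IsSemiRiemannian g) (hφ : ContMDiff I I' 2 φ)
    (hscalar : ∀ p, IsScalarProduct (E := E) (inducedMetric I g φ p)) :
    IsSemiRiemannian (inducedMetric I g φ) where
  isScalarProduct := hscalar
  differentiableAt p a b :=
    let ⟨_, hL, _⟩ := hg.exists_hasFDerivAt_metricInChart_inducedMetric hφ p a b
    hL.differentiableAt

theorem christoffelFirst_inducedMetric (hg : IsSemiRiemannian g) (hφ : ContMDiff I I' 2 φ) (p : M)
    (a b c : E) :
    christoffelFirst (inducedMetric I g φ) p a b c =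
      hg.form (φ p) (chartDeriv I I' φ p c) (ambientCovDeriv I g φ p a b) := by
  set A := chartDeriv I I' φ p
  set D := secondDerivInChart I I' φ p
  set Γ : E' := christoffel g (φ p) (A a) (A b)
  have hderiv (a b c : E) :
      fderiv ℝ (fun y => metricInChart (inducedMetric I g φ) p y b c) (extChartAt I p p) a =
        hg.formDeriv (φ p) (A a) (A b) (A c) + hg.form (φ p) (D a b) (A c)
          + hg.form (φ p) (A b) (D a c) :=
    hg.fderiv_metricInChart_inducedMetric hφ p a b c
  have hD : ∀ a b, D a b = D b a := secondDerivInChart_comm (hφ p)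
  have hΓ : hg.form (φ p) (A c) Γ = (hg.formDeriv (φ p) (A a) (A b) (A c)
      + hg.formDeriv (φ p) (A b) (A a) (A c) - hg.formDeriv (φ p) (A c) (A a) (A b)) / 2 :=
    (hg.form_christoffel _ _ _ _).trans (hg.christoffelFirst_eq _ _ _ _)
  calc christoffelFirst (inducedMetric I g φ) p a b c
      = hg.form (φ p) (A c) Γ + hg.form (φ p) (A c) (D a b) := by
        unfold christoffelFirst
        rw [hderiv, hderiv, hderiv, hΓ, hD c a, hD c b, hD b a, hg.form_comm _ (A c) (D a b),
          hg.form_comm _ (A b) (D a c)]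
        ring
    _ = hg.form (φ p) (A c) (D a b + Γ) := by
        rw [ContinuousLinearMap.map_add, add_comm]

variable [FiniteDimensional ℝ E]

theorem form_chartDeriv_secondFundamentalForm (hg : IsSemiRiemannian g)
    (hφ : ContMDiff I I' 2 φ)
    (hscalar : ∀ p, IsScalarProduct (E := E) (inducedMetric I g φ p)) (p : M) (a b c : E) :
    hg.form (φ p) (chartDeriv I I' φ p c) (secondFundamentalForm I g φ p a b) = 0 := by
  have hind := hg.inducedMetric hφ hscalar
  set A := chartDeriv I I' φ p
  set Γ : E := christoffel (inducedMetric I g φ) p a b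
  let N : E' := ambientCovDeriv I g φ p a b
  calc hg.form (φ p) (A c) (N - A Γ)
      = christoffelFirst (inducedMetric I g φ) p a b c - hind.form p c Γ := by
        rw [hg.christoffelFirst_inducedMetric hφ, ContinuousLinearMap.map_sub]
        rfl
    _ = 0 := sub_eq_zero.2 (hind.form_christoffel p a b c).symm

theorem secondFundamentalForm_eq_zero (hg : IsSemiRiemannian g) (hφ : ContMDiff I I' 2 φ)
    (hscalar : ∀ p, IsScalarProduct (E := E) (inducedMetric I g φ p)) {p : M}
    (hsurj : Function.Surjective (chartDeriv I I' φ p)) (a b : E) :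
    secondFundamentalForm I g φ p a b = (0 : E') := by
  refine (hg.isScalarProduct (φ p)).eq_of_apply_eq fun c' => ?_
  obtain ⟨c, rfl⟩ := hsurj c'
  exact (hg.form_chartDeriv_secondFundamentalForm hφ hscalar p a b c).trans
    ((hg.form (φ p) (chartDeriv I I' φ p c)).map_zero).symm

omit [I.Boundaryless] [IsManifold I 1 M] in
theorem isBilinearMap_hessian (hg : IsSemiRiemannian g) {f : M' → ℝ} {x : M'}
    (hf : ContMDiffAt I' 𝓘(ℝ, ℝ) 2 f x) : IsBilinearMap ℝ (hessian g f x : E' → E' → ℝ) := by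
  have hd := isBilinearMap_secondDerivInChart hf
  have hΓ := hg.isBilinearMap_christoffel x
  let df := chartDeriv I' 𝓘(ℝ, ℝ) f x
  change IsBilinearMap ℝ fun a b : E' =>
    secondDerivInChart I' 𝓘(ℝ, ℝ) f x a b - df (christoffel g x a b : E')
  refine ⟨fun _ _ _ => ?_, fun _ _ _ => ?_, fun _ _ _ => ?_, fun _ _ _ => ?_⟩
  · rw [hd.add_left, hΓ.add_left, map_add, add_sub_add_comm]
  · rw [hd.smul_left, hΓ.smul_left, map_smul, smul_sub]
  · rw [hd.add_right, hΓ.add_right, map_add, add_sub_add_comm]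
  · rw [hd.smul_right, hΓ.smul_right, map_smul, smul_sub]

theorem laplacian_comp_of_bijective (hg : IsSemiRiemannian g) (hφ : ContMDiff I I' 2 φ)
    (hbij : ∀ p, Function.Bijective (chartDeriv I I' φ p)) {f : M' → ℝ} {p : M}
    (hf : ContMDiffAt I' 𝓘(ℝ, ℝ) 2 f (φ p)) :
    laplacian (inducedMetric I g φ) (f ∘ φ) p = laplacian g f (φ p) := by
  let A (p : M) : E ≃ₗ[ℝ] E' := .ofBijective (chartDeriv I I' φ p).toLinearMap (hbij p)
  have hscalar (p : M) : IsScalarProduct (E := E) (inducedMetric I g φ p) :=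
    (hg.isScalarProduct (φ p)).comp (A p)
  have hhess (a b : E) : hessian (inducedMetric I g φ) (f ∘ φ) p a b =
      hessian g f (φ p) (A p a) (A p b) := by
    rw [hessian_comp g hf (hφ p), hg.secondFundamentalForm_eq_zero hφ hscalar (hbij p).2, map_zero,
      add_zero]
    rfl
  calc laplacian (inducedMetric I g φ) (f ∘ φ) p
      = metricTrace (fun a b => g (φ p) (A p a) (A p b))
          (fun a b => hessian g f (φ p) (A p a) (A p b)) :=
        congrArg (metricTrace (E := E) _) (funext fun a => funext (hhess a))
    _ = laplacian g f (φ p) :=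
        metricTrace_comp (hg.isScalarProduct (φ p)) (hg.isBilinearMap_hessian hf) (A p)

end IsSemiRiemannian

end InducedMetrics

theorem finrank_smul_meanCurvature {E : Type*} [NormedAddCommGroup E] [NormedSpace ℝ E]
    [FiniteDimensional ℝ E] {H : Type*} [TopologicalSpace H] (I : ModelWithCorners ℝ E H)
    {E' : Type*} [NormedAddCommGroup E'] [NormedSpace ℝ E'] [FiniteDimensional ℝ E']
    {H' : Type*} [TopologicalSpace H'] {I' : ModelWithCorners ℝ E' H'}
    {M : Type*} [TopologicalSpace M] [ChartedSpace H M]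
    {M' : Type*} [TopologicalSpace M'] [ChartedSpace H' M']
    (g : MetricField I' M') (φ : M → M') (p : M) :
    (Module.finrank ℝ E : ℝ) • meanCurvature I g φ p =
      metricTrace (E := E) (inducedMetric I g φ p) (secondFundamentalForm I g φ p) := by
  unfold meanCurvature
  rcases eq_or_ne (Module.finrank ℝ E) 0 with hE | hE
  · have : IsEmpty (Fin (Module.finrank ℝ E)) := by
      rw [hE]
      infer_instance
    simp [metricTrace]
  · rw [smul_smul, mul_one_div_cancel (Nat.cast_ne_zero.2 hE), one_smul]

section Parabolicity

variable {E : Type*} [NormedAddCommGroup E] [NormedSpace ℝ E] [FiniteDimensional ℝ E]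
  {H : Type*} [TopologicalSpace H] {I : ModelWithCorners ℝ E H}
  {M : Type*} [TopologicalSpace M] [ChartedSpace H M]

theorem hessian_neg (g : MetricField I M) (f : M → ℝ) (p : M) (a b : E) :
    hessian g (-f) p a b = -hessian g f p a b := by
  have hwritten : writtenInExtChartAt I 𝓘(ℝ, ℝ) p (-f) = -writtenInExtChartAt I 𝓘(ℝ, ℝ) p f := rfl
  have hsecond : secondDerivInChart I 𝓘(ℝ, ℝ) (-f) p a b =
      -secondDerivInChart I 𝓘(ℝ, ℝ) f p a b := by
    simp only [secondDerivInChart, hwritten, fderiv_neg, neg_apply, fderiv_fun_neg]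
  have hfirst : chartDeriv I 𝓘(ℝ, ℝ) (-f) p = -chartDeriv I 𝓘(ℝ, ℝ) f p := mfderiv_neg
  let Γ : E := christoffel g p a b
  calc hessian g (-f) p a b
      = secondDerivInChart I 𝓘(ℝ, ℝ) (-f) p a b - chartDeriv I 𝓘(ℝ, ℝ) (-f) p Γ := rfl
    _ = -(secondDerivInChart I 𝓘(ℝ, ℝ) f p a b - chartDeriv I 𝓘(ℝ, ℝ) f p Γ) := by
        rw [hsecond, hfirst, neg_apply]
        ring

theorem laplacian_neg (g : MetricField I M) (f : M → ℝ) (p : M) :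
    laplacian g (-f) p = -laplacian g f p := by
  have hhess : hessian g (-f) p = fun a b => -hessian g f p a b :=
    funext fun a => funext fun b => hessian_neg g f p a b
  unfold laplacian
  rw [hhess]
  exact (map_metricTrace (E := E) (-LinearMap.id) (g p) (hessian g f p)).symm

theorem IsParabolic.eq_const_of_bddAbove {g : MetricField I M} (hg : IsParabolic g) {f : M → ℝ}
    (hf : ContMDiff I 𝓘(ℝ, ℝ) 2 f) (hlap : ∀ x, 0 ≤ laplacian g f x) (hbdd : BddAbove (range f)) :
    ∃ c, ∀ x, f x = c := by
  obtain ⟨B, hB⟩ := hbdd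
  obtain ⟨c, hc⟩ := hg.eq_const (-f) hf.neg
    (fun x => (laplacian_neg g f x).trans_le (neg_nonpos.2 (hlap x)))
    ⟨-B, forall_mem_range.2 fun x => neg_le_neg (hB (mem_range_self x))⟩
  exact ⟨-c, fun x => neg_eq_iff_eq_neg.1 (hc x)⟩

end Parabolicity

section LocalIsometries

variable {E : Type*} [NormedAddCommGroup E] [NormedSpace ℝ E]
  {H : Type*} [TopologicalSpace H] {I : ModelWithCorners ℝ E H} [I.Boundaryless] {r : ℕ∞ω}
  {M : Type*} [TopologicalSpace M] [ChartedSpace H M] [IsManifold I 2 M]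

theorem contMDiffAt_mfderiv_extChartAt_symm (p : M) (a : E) :
    ContMDiffAt 𝓘(ℝ, E) I.tangent 1
      (fun y => (⟨(extChartAt I p).symm y, mfderiv 𝓘(ℝ, E) I (extChartAt I p).symm y a⟩ :
        TangentBundle I M)) (extChartAt I p p) := by
  have hopen : IsOpen (extChartAt I p).target := isOpen_extChartAt_target p
  have htarget : extChartAt I p p ∈ (extChartAt I p).target := mem_extChartAt_target p
  have hunique : UniqueMDiffOn 𝓘(ℝ, E) (extChartAt I p).target := hopen.uniqueMDiffOn
  have htangent := (contMDiffOn_extChartAt_symm (I := I) (n := 2) p).contMDiffOn_tangentMapWithin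
    (m := 1) (by norm_num) hunique
  have hconst : ContMDiffAt 𝓘(ℝ, E) 𝓘(ℝ, E).tangent 1
      (fun y => (⟨y, a⟩ : TangentBundle 𝓘(ℝ, E) E)) (extChartAt I p p) :=
    contMDiffAt_vectorSpace_iff_contDiffAt.2 contDiffAt_const
  have hcomp := ContMDiffWithinAt.comp (extChartAt I p p)
    (htangent ⟨extChartAt I p p, a⟩ htarget)
    (hconst.contMDiffWithinAt (s := (extChartAt I p).target)) fun y hy => hy
  refine (hcomp.contMDiffAt (hopen.mem_nhds htarget)).congr_of_eventuallyEq ?_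
  filter_upwards [hopen.mem_nhds htarget] with y hy
  exact (tangentMapWithin_eq_tangentMap (p := (⟨y, a⟩ : TangentBundle 𝓘(ℝ, E) E)) (hunique y hy)
    (mdifferentiableAt_extChartAt_symm_of_mem_target hy)).symm

theorem differentiableAt_metricInChart_riemMetric (hr : 1 ≤ r)
    (gM : ContMDiffRiemannianMetric I r E (TangentSpace I : M → Type _)) (p : M) (a b : E) :
    DifferentiableAt ℝ (fun y => metricInChart (riemMetric gM) p y a b) (extChartAt I p p) := by
  let _ : RiemannianBundle (fun x : M => TangentSpace I x) := ⟨gM.toRiemannianMetric⟩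
  have : IsContMDiffRiemannianBundle I 1 E (fun x : M => TangentSpace I x) :=
    ⟨gM.inner, gM.contMDiff.of_le hr, fun _ _ _ => rfl⟩
  have h := ContMDiffAt.inner_bundle (F := E) (E := fun x : M => TangentSpace I x)
    (v := fun y => mfderiv 𝓘(ℝ, E) I (extChartAt I p).symm y a)
    (w := fun y => mfderiv 𝓘(ℝ, E) I (extChartAt I p).symm y b)
    (contMDiffAt_mfderiv_extChartAt_symm (I := I) p a)
    (contMDiffAt_mfderiv_extChartAt_symm (I := I) p b)
  exact (contMDiffAt_iff_contDiffAt.1 h).differentiableAt one_ne_zero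

theorem isSemiRiemannian_riemMetric (hr : 1 ≤ r)
    (gM : ContMDiffRiemannianMetric I r E (TangentSpace I : M → Type _)) :
    IsSemiRiemannian (riemMetric gM) where
  isScalarProduct x :=
    { isBilinearMap := isBilinearMap_riemMetric gM x
      symm := gM.symm x
      eq_zero_of_apply_eq_zero := fun a ha => by_contra fun hne => (gM.pos x a hne).ne' (ha a) }
  differentiableAt := differentiableAt_metricInChart_riemMetric hr gM

theorem isParabolic_of_inducedMetric [FiniteDimensional ℝ E] [T2Space M] [PreconnectedSpace M]
    (hr : 1 ≤ r) (gM : ContMDiffRiemannianMetric I r E (TangentSpace I : M → Type _))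
    {E' : Type*} [NormedAddCommGroup E'] [NormedSpace ℝ E'] [FiniteDimensional ℝ E']
    {H' : Type*} [TopologicalSpace H'] {I' : ModelWithCorners ℝ E' H'} [I'.Boundaryless]
    {S : Type*} [TopologicalSpace S] [ChartedSpace H' S] [IsManifold I' 1 S] [Nonempty S]
    {φ : S → M} (hφ : ContMDiff I' I 2 φ)
    (hbij : ∀ p, Function.Bijective (chartDeriv I' I φ p))
    (hpar : IsParabolic (inducedMetric I' (riemMetric gM) φ)) : IsParabolic (riemMetric gM) := by
  have : LocallyCompactSpace M := Manifold.locallyCompact_of_finiteDimensional I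
  have hφ1 : ContMDiff I' I 1 φ := hφ.of_le one_le_two
  have hsurj := surjective_of_isCompleteMetric hφ1 (fun p => (hbij p).2) hpar.complete
  refine ⟨isCompleteMetric_of_surjective hφ1 (fun p => (hbij p).2) hsurj hpar.complete,
    fun f hf hlap hbdd => ?_⟩
  obtain ⟨c, hc⟩ := hpar.eq_const (f ∘ φ) (hf.comp hφ)
    (fun p => ((isSemiRiemannian_riemMetric hr gM).laplacian_comp_of_bijective hφ hbij
      (hf (φ p))).trans_le (hlap (φ p)))
    (hbdd.mono (range_comp_subset_range φ f))
  exact ⟨c, hsurj.forall.2 hc⟩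

end LocalIsometries

section WaveGeometry

variable {n : ℕ} {M : Type*} [TopologicalSpace M] [ChartedSpace (EuclideanSpace ℝ (Fin n)) M]

theorem coe_extChartAt_wave (q : (ℝ × ℝ) × M) :
    ⇑(extChartAt (waveModel n) q) = Prod.map id (extChartAt (𝓡 n) q.2) := by
  rw [extChartAt_prod]
  rfl

theorem coe_extChartAt_wave_symm (q : (ℝ × ℝ) × M) :
    ⇑(extChartAt (waveModel n) q).symm = Prod.map id (extChartAt (𝓡 n) q.2).symm := by
  rw [extChartAt_prod]
  rfl

/-- The coordinate function `u` of a plane fronted wave. -/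
def uCoord (q : (ℝ × ℝ) × M) : ℝ := q.1.1

theorem contMDiff_uCoord {m : ℕ∞ω} : ContMDiff (waveModel n) 𝓘(ℝ, ℝ) m (uCoord (M := M)) :=
  contDiff_fst.contMDiff.comp contMDiff_fst

theorem writtenInExtChartAt_uCoord (q : (ℝ × ℝ) × M) :
    writtenInExtChartAt (waveModel n) 𝓘(ℝ, ℝ) q uCoord = fun y => y.1.1 := by
  funext y
  simp only [writtenInExtChartAt, Function.comp_apply, coe_extChartAt_wave_symm]
  rfl

theorem fderiv_fst_fst (y : (ℝ × ℝ) × EuclideanSpace ℝ (Fin n)) :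
    fderiv ℝ (fun y : (ℝ × ℝ) × EuclideanSpace ℝ (Fin n) => y.1.1) y =
      (ContinuousLinearMap.fst ℝ ℝ ℝ).comp (ContinuousLinearMap.fst ℝ (ℝ × ℝ) _) :=
  ((ContinuousLinearMap.fst ℝ ℝ ℝ).comp
    (ContinuousLinearMap.fst ℝ (ℝ × ℝ) (EuclideanSpace ℝ (Fin n)))).fderiv (x := y)

theorem secondDerivInChart_uCoord (q : (ℝ × ℝ) × M)
    (a b : (ℝ × ℝ) × EuclideanSpace ℝ (Fin n)) :
    secondDerivInChart (waveModel n) 𝓘(ℝ, ℝ) uCoord q a b = 0 := by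
  simp only [secondDerivInChart, writtenInExtChartAt_uCoord, fderiv_fst_fst, fderiv_fun_const,
    Pi.zero_apply, zero_apply]

theorem chartDeriv_uCoord (q : (ℝ × ℝ) × M) (a : (ℝ × ℝ) × EuclideanSpace ℝ (Fin n)) :
    chartDeriv (waveModel n) 𝓘(ℝ, ℝ) uCoord q a = a.1.1 := by
  rw [chartDeriv_eq_fderiv_writtenInExtChartAt
    (contMDiff_uCoord.mdifferentiableAt (n := 1) one_ne_zero), writtenInExtChartAt_uCoord,
    fderiv_fst_fst]
  rfl

variable [IsManifold (𝓡 n) ∞ M]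
  (gM : ContMDiffRiemannianMetric (𝓡 n) ∞ (EuclideanSpace ℝ (Fin n))
  (TangentSpace (𝓡 n) : M → Type _)) (𝓗 : ℝ × M → ℝ)

theorem waveMetric_apply (q : (ℝ × ℝ) × M) (a b : (ℝ × ℝ) × EuclideanSpace ℝ (Fin n)) :
    waveMetric gM 𝓗 q a b = 𝓗 (q.1.1, q.2) * a.1.1 * b.1.1 + a.1.1 * b.1.2 + a.1.2 * b.1.1
      + riemMetric gM q.2 a.2 b.2 := rfl

theorem riemMetric_zero_right (x : M) (a : EuclideanSpace ℝ (Fin n)) :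
    riemMetric gM x a (0 : EuclideanSpace ℝ (Fin n)) = 0 := (gM.inner x a).map_zero

theorem waveMetric_partialV (q : (ℝ × ℝ) × M) (a : (ℝ × ℝ) × EuclideanSpace ℝ (Fin n)) :
    waveMetric gM 𝓗 q a (partialV q) = a.1.1 := by
  refine (waveMetric_apply gM 𝓗 q a ((0, 1), 0)).trans ?_
  simp [riemMetric_zero_right]

theorem isBilinearMap_waveMetric (q : (ℝ × ℝ) × M) :
    IsBilinearMap ℝ (waveMetric gM 𝓗 q : (ℝ × ℝ) × EuclideanSpace ℝ (Fin n) →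
      (ℝ × ℝ) × EuclideanSpace ℝ (Fin n) → ℝ) := by
  have hgM : IsBilinearMap ℝ fun a b : EuclideanSpace ℝ (Fin n) => riemMetric gM q.2 a b :=
    isBilinearMap_riemMetric gM q.2
  change IsBilinearMap ℝ fun a b : (ℝ × ℝ) × EuclideanSpace ℝ (Fin n) =>
    𝓗 (q.1.1, q.2) * a.1.1 * b.1.1 + a.1.1 * b.1.2 + a.1.2 * b.1.1 + riemMetric gM q.2 a.2 b.2
  refine ⟨fun a a' b => ?_, fun r a b => ?_, fun a b b' => ?_, fun r a b => ?_⟩ <;>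
    simp only [Prod.fst_add, Prod.snd_add, Prod.smul_fst, Prod.smul_snd, smul_eq_mul,
      hgM.add_left, hgM.smul_left, hgM.add_right, hgM.smul_right] <;>
    ring

theorem isScalarProduct_waveMetric (q : (ℝ × ℝ) × M) :
    IsScalarProduct (E := (ℝ × ℝ) × EuclideanSpace ℝ (Fin n)) (waveMetric gM 𝓗 q) where
  isBilinearMap := isBilinearMap_waveMetric gM 𝓗 q
  symm a b := by
    have hgM : riemMetric gM q.2 a.2 b.2 = riemMetric gM q.2 b.2 a.2 := gM.symm q.2 a.2 b.2
    rw [waveMetric_apply, waveMetric_apply, hgM]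
    ring
  eq_zero_of_apply_eq_zero a ha := by
    have hu : a.1.1 = 0 := (waveMetric_partialV gM 𝓗 q a).symm.trans (ha (partialV q))
    have hv : a.1.2 = 0 := by
      simpa [waveMetric_apply, riemMetric_zero_right, hu] using ha ((1, 0), 0)
    have hx : a.2 = 0 := by
      by_contra hne
      have hgM : riemMetric gM q.2 a.2 a.2 = 0 := by simpa [waveMetric_apply, hu, hv] using ha a
      exact (gM.pos q.2 a.2 hne).ne' hgM
    exact Prod.ext (Prod.ext hu hv) hx

theorem metricInChart_waveMetric (q : (ℝ × ℝ) × M) {y : (ℝ × ℝ) × EuclideanSpace ℝ (Fin n)}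
    (hy : y.2 ∈ (extChartAt (𝓡 n) q.2).target) (a b : (ℝ × ℝ) × EuclideanSpace ℝ (Fin n)) :
    metricInChart (waveMetric gM 𝓗) q y a b =
      𝓗 (y.1.1, (extChartAt (𝓡 n) q.2).symm y.2) * a.1.1 * b.1.1 + a.1.1 * b.1.2
        + a.1.2 * b.1.1 + metricInChart (riemMetric gM) q.2 y.2 a.2 b.2 := by
  have hderiv : chartDeriv 𝓘(ℝ, (ℝ × ℝ) × EuclideanSpace ℝ (Fin n)) (waveModel n)
      (extChartAt (waveModel n) q).symm y =
      (ContinuousLinearMap.id ℝ (ℝ × ℝ)).prodMap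
        (chartDeriv 𝓘(ℝ, EuclideanSpace ℝ (Fin n)) (𝓡 n) (extChartAt (𝓡 n) q.2).symm y.2) := by
    rw [coe_extChartAt_wave_symm, chartDeriv, modelWithCornersSelf_prod, ← chartedSpaceSelf_prod]
    refine (mfderiv_prodMap mdifferentiableAt_id
      (mdifferentiableAt_extChartAt_symm_of_mem_target hy)).trans ?_
    rw [mfderiv_id]
    rfl
  calc metricInChart (waveMetric gM 𝓗) q y a b
      = waveMetric gM 𝓗 ((extChartAt (waveModel n) q).symm y)
          (chartDeriv 𝓘(ℝ, (ℝ × ℝ) × EuclideanSpace ℝ (Fin n)) (waveModel n)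
            (extChartAt (waveModel n) q).symm y a)
          (chartDeriv 𝓘(ℝ, (ℝ × ℝ) × EuclideanSpace ℝ (Fin n)) (waveModel n)
            (extChartAt (waveModel n) q).symm y b) := rfl
    _ = _ := by
      rw [hderiv]
      exact metricField_congr (waveMetric gM 𝓗) (congrFun (coe_extChartAt_wave_symm q) y) _ _

theorem differentiableAt_metricInChart_waveMetric
    (h𝓗 : MDifferentiable (𝓘(ℝ, ℝ).prod (𝓡 n)) 𝓘(ℝ, ℝ) 𝓗) (q : (ℝ × ℝ) × M)
    (a b : (ℝ × ℝ) × EuclideanSpace ℝ (Fin n)) :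
    DifferentiableAt ℝ (fun y => metricInChart (waveMetric gM 𝓗) q y a b)
      (extChartAt (waveModel n) q q) := by
  rw [coe_extChartAt_wave, Prod.map_apply, id_eq]
  set x := extChartAt (𝓡 n) q.2 q.2
  have hpoint : MDifferentiableAt 𝓘(ℝ, (ℝ × ℝ) × EuclideanSpace ℝ (Fin n))
      (𝓘(ℝ, ℝ).prod (𝓡 n)) (fun y : (ℝ × ℝ) × EuclideanSpace ℝ (Fin n) =>
        (y.1.1, (extChartAt (𝓡 n) q.2).symm y.2)) (q.1, x) :=
    differentiableAt_fst.fst.mdifferentiableAt.prodMk <|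
      MDifferentiableAt.comp (I' := 𝓘(ℝ, EuclideanSpace ℝ (Fin n))) (q.1, x)
        (mdifferentiableAt_extChartAt_symm_of_mem_target (mem_extChartAt_target q.2))
        differentiableAt_snd.mdifferentiableAt
  have hprofile : DifferentiableAt ℝ (fun y : (ℝ × ℝ) × EuclideanSpace ℝ (Fin n) =>
      𝓗 (y.1.1, (extChartAt (𝓡 n) q.2).symm y.2)) (q.1, x) :=
    mdifferentiableAt_iff_differentiableAt.1 ((h𝓗 _).comp (q.1, x) hpoint)
  have hriem : DifferentiableAt ℝ (fun y : (ℝ × ℝ) × EuclideanSpace ℝ (Fin n) =>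
      metricInChart (riemMetric gM) q.2 y.2 a.2 b.2) (q.1, x) :=
    DifferentiableAt.comp (q.1, x) (g := fun y => metricInChart (riemMetric gM) q.2 y a.2 b.2)
      (differentiableAt_metricInChart_riemMetric (by simp) gM q.2 a.2 b.2) differentiableAt_snd
  have hflat := ((hprofile.mul_const a.1.1).mul_const b.1.1).add_const (a.1.1 * b.1.2)
  refine ((hflat.add_const (a.1.2 * b.1.1)).add hriem).congr_of_eventuallyEq ?_
  filter_upwards [continuousAt_snd.eventually (extChartAt_target_mem_nhds (I := 𝓡 n) q.2)] with y hy
  exact metricInChart_waveMetric gM 𝓗 q hy a b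

variable {𝓗}

theorem isSemiRiemannian_waveMetric (h𝓗 : MDifferentiable (𝓘(ℝ, ℝ).prod (𝓡 n)) 𝓘(ℝ, ℝ) 𝓗) :
    IsSemiRiemannian (waveMetric gM 𝓗) where
  isScalarProduct := isScalarProduct_waveMetric gM 𝓗
  differentiableAt := differentiableAt_metricInChart_waveMetric gM 𝓗 h𝓗

variable (𝓗)

theorem metricInChart_waveMetric_partialV (q : (ℝ × ℝ) × M)
    {y : (ℝ × ℝ) × EuclideanSpace ℝ (Fin n)} (hy : y.2 ∈ (extChartAt (𝓡 n) q.2).target)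
    (a : (ℝ × ℝ) × EuclideanSpace ℝ (Fin n)) :
    metricInChart (waveMetric gM 𝓗) q y a (partialV q) = a.1.1 := by
  have hzero : metricInChart (riemMetric gM) q.2 y.2 a.2 (0 : EuclideanSpace ℝ (Fin n)) = 0 :=
    (congrArg (riemMetric gM _ _) (chartDeriv 𝓘(ℝ, EuclideanSpace ℝ (Fin n)) (𝓡 n)
      (extChartAt (𝓡 n) q.2).symm y.2).map_zero).trans (riemMetric_zero_right gM _ _)
  refine (metricInChart_waveMetric gM 𝓗 q hy a ((0, 1), 0)).trans ?_
  simp [hzero]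

theorem fderiv_metricInChart_waveMetric_partialV (q : (ℝ × ℝ) × M)
    (a : (ℝ × ℝ) × EuclideanSpace ℝ (Fin n)) :
    fderiv ℝ (fun y => metricInChart (waveMetric gM 𝓗) q y a (partialV q))
      (extChartAt (waveModel n) q q) = 0 := by
  rw [coe_extChartAt_wave, Prod.map_apply, id_eq]
  have hconst : (fun y => metricInChart (waveMetric gM 𝓗) q y a (partialV q))
      =ᶠ[𝓝 (q.1, extChartAt (𝓡 n) q.2 q.2)] fun _ => a.1.1 := by
    filter_upwards [continuousAt_snd.eventually (extChartAt_target_mem_nhds (I := 𝓡 n) q.2)]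
      with y hy
    exact metricInChart_waveMetric_partialV gM 𝓗 q hy a
  rw [hconst.fderiv_eq, fderiv_fun_const, Pi.zero_apply]

variable {𝓗}

theorem fderiv_metricInChart_waveMetric_apply_partialV
    (h𝓗 : MDifferentiable (𝓘(ℝ, ℝ).prod (𝓡 n)) 𝓘(ℝ, ℝ) 𝓗) (q : (ℝ × ℝ) × M)
    (a b : (ℝ × ℝ) × EuclideanSpace ℝ (Fin n)) :
    fderiv ℝ (fun y => metricInChart (waveMetric gM 𝓗) q y a b)
      (extChartAt (waveModel n) q q) (partialV q) = 0 := by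
  have hdiff := differentiableAt_metricInChart_waveMetric gM 𝓗 h𝓗 q a b
  refine hdiff.lineDeriv_eq_fderiv.symm.trans ?_
  rw [coe_extChartAt_wave, Prod.map_apply, id_eq]
  set x := extChartAt (𝓡 n) q.2 q.2
  have hconst (t : ℝ) : metricInChart (waveMetric gM 𝓗) q
      ((q.1, x) + t • (((0, 1), 0) : (ℝ × ℝ) × EuclideanSpace ℝ (Fin n))) a b =
        metricInChart (waveMetric gM 𝓗) q (q.1, x) a b := by
    have hx : x ∈ (extChartAt (𝓡 n) q.2).target := mem_extChartAt_target q.2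
    rw [metricInChart_waveMetric gM 𝓗 q (by simpa using hx),
      metricInChart_waveMetric gM 𝓗 q hx]
    simp
  exact (congrArg (deriv · 0) (funext hconst)).trans (deriv_const 0 _)

theorem christoffelFirst_waveMetric_partialV
    (h𝓗 : MDifferentiable (𝓘(ℝ, ℝ).prod (𝓡 n)) 𝓘(ℝ, ℝ) 𝓗) (q : (ℝ × ℝ) × M)
    (a b : (ℝ × ℝ) × EuclideanSpace ℝ (Fin n)) :
    christoffelFirst (waveMetric gM 𝓗) q a b (partialV q) = 0 := by
  unfold christoffelFirst
  rw [fderiv_metricInChart_waveMetric_partialV, fderiv_metricInChart_waveMetric_partialV,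
    fderiv_metricInChart_waveMetric_apply_partialV gM h𝓗]
  simp

theorem christoffel_waveMetric_fst_fst (h𝓗 : MDifferentiable (𝓘(ℝ, ℝ).prod (𝓡 n)) 𝓘(ℝ, ℝ) 𝓗)
    (q : (ℝ × ℝ) × M) (a b : (ℝ × ℝ) × EuclideanSpace ℝ (Fin n)) :
    (christoffel (waveMetric gM 𝓗) q a b).1.1 = 0 := by
  have hg := isSemiRiemannian_waveMetric gM h𝓗
  let Γ : (ℝ × ℝ) × EuclideanSpace ℝ (Fin n) := christoffel (waveMetric gM 𝓗) q a b
  calc Γ.1.1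
      = hg.form q Γ (partialV q) := (waveMetric_partialV gM 𝓗 q Γ).symm
    _ = hg.form q (partialV q) Γ := hg.form_comm q _ _
    _ = christoffelFirst (waveMetric gM 𝓗) q a b (partialV q) := hg.form_christoffel q a b _
    _ = 0 := christoffelFirst_waveMetric_partialV gM h𝓗 q a b

/-- `∂_v = grad u` is parallel. -/
theorem hessian_uCoord (h𝓗 : MDifferentiable (𝓘(ℝ, ℝ).prod (𝓡 n)) 𝓘(ℝ, ℝ) 𝓗)
    (q : (ℝ × ℝ) × M) (a b : (ℝ × ℝ) × EuclideanSpace ℝ (Fin n)) :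
    hessian (waveMetric gM 𝓗) uCoord q a b = 0 := by
  let Γ : (ℝ × ℝ) × EuclideanSpace ℝ (Fin n) := christoffel (waveMetric gM 𝓗) q a b
  calc hessian (waveMetric gM 𝓗) uCoord q a b
      = secondDerivInChart (waveModel n) 𝓘(ℝ, ℝ) uCoord q a b
          - chartDeriv (waveModel n) 𝓘(ℝ, ℝ) uCoord q Γ := rfl
    _ = 0 - Γ.1.1 := by rw [secondDerivInChart_uCoord, chartDeriv_uCoord]
    _ = 0 := by rw [christoffel_waveMetric_fst_fst gM h𝓗, sub_zero]

end WaveGeometry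

section Submanifolds

variable {n : ℕ} {M : Type*} [TopologicalSpace M] [ChartedSpace (EuclideanSpace ℝ (Fin n)) M]
  {E : Type*} [NormedAddCommGroup E] [NormedSpace ℝ E]
  {H : Type*} [TopologicalSpace H] {I : ModelWithCorners ℝ E H}
  {S : Type*} [TopologicalSpace S] [ChartedSpace H S] {ψ : S → (ℝ × ℝ) × M}

theorem chartDeriv_snd_comp {p : S} (hψ : MDifferentiableAt I (waveModel n) ψ p) (a : E) :
    chartDeriv I (𝓡 n) (fun p => (ψ p).2) p a = (chartDeriv I (waveModel n) ψ p a).2 := by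
  have hcomp := mfderiv_comp p (g := Prod.snd) (mdifferentiableAt_snd (I := 𝓘(ℝ, ℝ × ℝ))) hψ
  rw [mfderiv_snd] at hcomp
  exact congrArg (fun L : E →L[ℝ] EuclideanSpace ℝ (Fin n) => L a) hcomp

theorem chartDeriv_fst_fst_eq_zero {p : S} (hψ : MDifferentiableAt I (waveModel n) ψ p) {u₀ : ℝ}
    (hu : ∀ p, (ψ p).1.1 = u₀) (a : E) : (chartDeriv I (waveModel n) ψ p a).1.1 = 0 := by
  have hconst : uCoord ∘ ψ = fun _ => u₀ := funext hu
  calc (chartDeriv I (waveModel n) ψ p a).1.1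
      = chartDeriv (waveModel n) 𝓘(ℝ, ℝ) uCoord (ψ p) (chartDeriv I (waveModel n) ψ p a) :=
        (chartDeriv_uCoord _ _).symm
    _ = chartDeriv I 𝓘(ℝ, ℝ) (uCoord ∘ ψ) p a :=
        (congrArg (fun L : E →L[ℝ] ℝ => L a) (mfderiv_comp p
          (contMDiff_uCoord.mdifferentiableAt (n := 1) one_ne_zero) hψ)).symm
    _ = 0 := by
        rw [hconst]
        exact congrArg (fun L : E →L[ℝ] ℝ => L a) mfderiv_const

variable [IsManifold (𝓡 n) ∞ M]
  (gM : ContMDiffRiemannianMetric (𝓡 n) ∞ (EuclideanSpace ℝ (Fin n))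
    (TangentSpace (𝓡 n) : M → Type _)) {𝓗 : ℝ × M → ℝ}

theorem inducedMetric_waveMetric_of_const (hψ : MDifferentiable I (waveModel n) ψ) {u₀ : ℝ}
    (hu : ∀ p, (ψ p).1.1 = u₀) :
    inducedMetric I (waveMetric gM 𝓗) ψ = inducedMetric I (riemMetric gM) fun p => (ψ p).2 := by
  refine funext fun p => funext fun (a : E) => funext fun (b : E) => ?_
  let A := chartDeriv I (waveModel n) ψ p
  calc waveMetric gM 𝓗 (ψ p) (A a) (A b)
      = riemMetric gM (ψ p).2 (A a).2 (A b).2 := by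
        rw [waveMetric_apply, chartDeriv_fst_fst_eq_zero (hψ p) hu,
          chartDeriv_fst_fst_eq_zero (hψ p) hu]
        ring
    _ = riemMetric gM (ψ p).2 (chartDeriv I (𝓡 n) (fun p => (ψ p).2) p a)
          (chartDeriv I (𝓡 n) (fun p => (ψ p).2) p b) := by
        rw [chartDeriv_snd_comp (hψ p), chartDeriv_snd_comp (hψ p)]

theorem inducedMetric_wavefront (u₀ v₀ : ℝ) :
    inducedMetric (𝓡 n) (waveMetric gM 𝓗) (wavefront u₀ v₀ : M → (ℝ × ℝ) × M) =
      riemMetric gM := by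
  have hψ : MDifferentiable (𝓡 n) (waveModel n) (wavefront u₀ v₀ : M → (ℝ × ℝ) × M) :=
    mdifferentiable_const.prodMk mdifferentiable_id
  have hid (x : M) : mfderiv (𝓡 n) (𝓡 n) (fun x : M => (wavefront u₀ v₀ x).2) x = .id ℝ _ :=
    mfderiv_id
  rw [inducedMetric_waveMetric_of_const gM hψ fun _ => rfl]
  unfold inducedMetric
  simp only [hid]
  rfl

theorem bijective_chartDeriv_snd_comp [FiniteDimensional ℝ E]
    (hE : Module.finrank ℝ E = n) (hψ : IsSpacelikeSubmanifold I (waveMetric gM 𝓗) ψ) {u₀ : ℝ}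
    (hu : ∀ p, (ψ p).1.1 = u₀) (p : S) :
    Function.Bijective (chartDeriv I (𝓡 n) (fun p => (ψ p).2) p) := by
  have hψd : MDifferentiable I (waveModel n) ψ := hψ.contMDiff.mdifferentiable (by simp)
  set A := chartDeriv I (𝓡 n) (fun p => (ψ p).2) p
  have hinj : Function.Injective A.toLinearMap := by
    refine (injective_iff_map_eq_zero _).2 fun a ha => by_contra fun hne => ?_
    have hpos := hψ.spacelike p a hne
    rw [inducedMetric_waveMetric_of_const gM hψd hu] at hpos
    have hzero : riemMetric gM (ψ p).2 (A a) (A a) = 0 :=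
      (congrArg (riemMetric gM (ψ p).2 (A a)) ha).trans (riemMetric_zero_right gM _ _)
    exact hpos.ne' hzero
  exact ⟨hinj, (LinearMap.injective_iff_surjective_of_finrank_eq_finrank
    (hE.trans finrank_euclideanSpace_fin.symm)).1 hinj⟩

variable [FiniteDimensional ℝ E] [I.Boundaryless]

theorem hessian_uCoord_comp (h𝓗 : MDifferentiable (𝓘(ℝ, ℝ).prod (𝓡 n)) 𝓘(ℝ, ℝ) 𝓗) {p : S}
    (hψ : ContMDiffAt I (waveModel n) 2 ψ p) (a b : E) :
    hessian (inducedMetric I (waveMetric gM 𝓗) ψ) (uCoord ∘ ψ) p a b =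
      waveMetric gM 𝓗 (ψ p) (secondFundamentalForm I (waveMetric gM 𝓗) ψ p a b)
        (partialV (ψ p)) := by
  rw [hessian_comp _ contMDiff_uCoord.contMDiffAt hψ, hessian_uCoord gM h𝓗, zero_add]
  exact (chartDeriv_uCoord _ _).trans (waveMetric_partialV gM 𝓗 _ _).symm

theorem laplacian_uCoord_comp (h𝓗 : MDifferentiable (𝓘(ℝ, ℝ).prod (𝓡 n)) 𝓘(ℝ, ℝ) 𝓗) {p : S}
    (hψ : ContMDiffAt I (waveModel n) 2 ψ p) :
    laplacian (inducedMetric I (waveMetric gM 𝓗) ψ) (uCoord ∘ ψ) p =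
      Module.finrank ℝ E * waveMetric gM 𝓗 (ψ p) (meanCurvature I (waveMetric gM 𝓗) ψ p)
        (partialV (ψ p)) := by
  let du : (ℝ × ℝ) × EuclideanSpace ℝ (Fin n) →ₗ[ℝ] ℝ := .fst ℝ ℝ ℝ ∘ₗ .fst ℝ (ℝ × ℝ) _
  let II : E → E → (ℝ × ℝ) × EuclideanSpace ℝ (Fin n) :=
    secondFundamentalForm I (waveMetric gM 𝓗) ψ p
  let N : (ℝ × ℝ) × EuclideanSpace ℝ (Fin n) := meanCurvature I (waveMetric gM 𝓗) ψ p
  let B : E → E → ℝ := inducedMetric I (waveMetric gM 𝓗) ψ p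
  have hhess : hessian (inducedMetric I (waveMetric gM 𝓗) ψ) (uCoord ∘ ψ) p =
      fun a b : E => du (II a b) :=
    funext fun a => funext fun b =>
      (hessian_uCoord_comp gM h𝓗 hψ a b).trans (waveMetric_partialV gM 𝓗 _ _)
  calc laplacian (inducedMetric I (waveMetric gM 𝓗) ψ) (uCoord ∘ ψ) p
      = metricTrace B fun a b => du (II a b) := congrArg (metricTrace B) hhess
    _ = du (metricTrace B II) := (map_metricTrace du B II).symm
    _ = du ((Module.finrank ℝ E : ℝ) • N) :=
        congrArg du (finrank_smul_meanCurvature I (waveMetric gM 𝓗) ψ p).symm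
    _ = Module.finrank ℝ E * du N := du.map_smul _ N
    _ = Module.finrank ℝ E * waveMetric gM 𝓗 (ψ p) N (partialV (ψ p)) := by
        rw [waveMetric_partialV]
        rfl

theorem exists_uCoord_eq_const (h𝓗 : MDifferentiable (𝓘(ℝ, ℝ).prod (𝓡 n)) 𝓘(ℝ, ℝ) 𝓗)
    (hψ : ContMDiff I (waveModel n) 2 ψ)
    (hpar : IsParabolic (inducedMetric I (waveMetric gM 𝓗) ψ))
    (hH :
      ((∀ p, 0 ≤ waveMetric gM 𝓗 (ψ p)
            (meanCurvature I (waveMetric gM 𝓗) ψ p) (partialV (ψ p))) ∧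
        BddAbove (range fun p => (ψ p).1.1)) ∨
      ((∀ p, waveMetric gM 𝓗 (ψ p)
            (meanCurvature I (waveMetric gM 𝓗) ψ p) (partialV (ψ p)) ≤ 0) ∧
        BddBelow (range fun p => (ψ p).1.1))) :
    ∃ u₀ : ℝ, ∀ p, (ψ p).1.1 = u₀ := by
  have hu : ContMDiff I 𝓘(ℝ, ℝ) 2 (uCoord ∘ ψ) := contMDiff_uCoord.comp hψ
  rcases hH with ⟨hH, hbdd⟩ | ⟨hH, hbdd⟩
  · refine hpar.eq_const_of_bddAbove (f := uCoord ∘ ψ) hu (fun p => ?_) hbdd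
    rw [laplacian_uCoord_comp gM h𝓗 (hψ p)]
    exact mul_nonneg (Nat.cast_nonneg _) (hH p)
  · refine hpar.eq_const (uCoord ∘ ψ) hu (fun p => ?_) hbdd
    rw [laplacian_uCoord_comp gM h𝓗 (hψ p)]
    exact mul_nonpos_of_nonneg_of_nonpos (Nat.cast_nonneg _) (hH p)

end Submanifolds

end PlaneFrontedWave

end

open PlaneFrontedWave in
theorem mainTheorem5_general {n : ℕ}
    {M : Type*} [TopologicalSpace M] [ChartedSpace (EuclideanSpace ℝ (Fin n)) M]
    [IsManifold (𝓡 n) ∞ M] [T2Space M] [PreconnectedSpace M]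
    (gM : ContMDiffRiemannianMetric (𝓡 n) ∞ (EuclideanSpace ℝ (Fin n))
      (TangentSpace (𝓡 n) : M → Type _))
    {𝓗 : ℝ × M → ℝ} (h𝓗 : MDifferentiable (𝓘(ℝ, ℝ).prod (𝓡 n)) 𝓘(ℝ, ℝ) 𝓗)
    {E : Type*} [NormedAddCommGroup E] [NormedSpace ℝ E] [FiniteDimensional ℝ E]
    {H : Type*} [TopologicalSpace H] {I : ModelWithCorners ℝ E H} [I.Boundaryless]
    {S : Type*} [TopologicalSpace S] [ChartedSpace H S] [IsManifold I 1 S] [Nonempty S]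
    {ψ : S → (ℝ × ℝ) × M} (hψ : IsSpacelikeSubmanifold I (waveMetric gM 𝓗) ψ)
    (hpar : IsParabolic (inducedMetric I (waveMetric gM 𝓗) ψ))
    (hH :
      ((∀ p, 0 ≤ waveMetric gM 𝓗 (ψ p)
            (meanCurvature I (waveMetric gM 𝓗) ψ p) (partialV (ψ p))) ∧
        BddAbove (range fun p => (ψ p).1.1)) ∨
      ((∀ p, waveMetric gM 𝓗 (ψ p)
            (meanCurvature I (waveMetric gM 𝓗) ψ p) (partialV (ψ p)) ≤ 0) ∧
        BddBelow (range fun p => (ψ p).1.1))) :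
    ∃ u₀ : ℝ, (∀ p, (ψ p).1.1 = u₀) ∧
      (Module.finrank ℝ E = n →
        ∀ v₀ : ℝ, IsParabolic (inducedMetric (𝓡 n) (waveMetric gM 𝓗)
          (wavefront u₀ v₀ : M → (ℝ × ℝ) × M))) := by
  have hψ2 : ContMDiff I (waveModel n) 2 ψ := hψ.contMDiff.of_le (WithTop.coe_le_coe.2 le_top)
  obtain ⟨u₀, hu⟩ := exists_uCoord_eq_const gM h𝓗 hψ2 hpar hH
  refine ⟨u₀, hu, fun hE v₀ => ?_⟩
  rw [inducedMetric_wavefront]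
  rw [inducedMetric_waveMetric_of_const gM (hψ2.mdifferentiable two_ne_zero) hu] at hpar
  exact isParabolic_of_inducedMetric (by simp) gM (contMDiff_snd.comp hψ2)
    (bijective_chartDeriv_snd_comp gM hE hψ hu) hpar

open PlaneFrontedWave in
theorem mainTheorem5 {n k : ℕ}
    {M : Type*} [TopologicalSpace M] [ChartedSpace (EuclideanSpace ℝ (Fin n)) M]
    [IsManifold (𝓡 n) ∞ M] [T2Space M] [SecondCountableTopology M] [ConnectedSpace M]
    (gM : ContMDiffRiemannianMetric (𝓡 n) ∞ (EuclideanSpace ℝ (Fin n))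
      (TangentSpace (𝓡 n) : M → Type _))
    (𝓗 : ℝ × M → ℝ) (h𝓗 : ContMDiff (𝓘(ℝ, ℝ).prod (𝓡 n)) 𝓘(ℝ, ℝ) ∞ 𝓗)
    {S : Type*} [TopologicalSpace S] [ChartedSpace (EuclideanSpace ℝ (Fin k)) S]
    [IsManifold (𝓡 k) ∞ S] [T2Space S] [SecondCountableTopology S] [ConnectedSpace S]
    (ψ : S → (ℝ × ℝ) × M)
    (hψ : IsSpacelikeSubmanifold (𝓡 k) (waveMetric gM 𝓗) ψ)
    (hpar : IsParabolic (inducedMetric (𝓡 k) (waveMetric gM 𝓗) ψ))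
    (hH :
      ((∀ p, 0 ≤ waveMetric gM 𝓗 (ψ p)
            (meanCurvature (𝓡 k) (waveMetric gM 𝓗) ψ p) (partialV (ψ p))) ∧
        BddAbove (range fun p => (ψ p).1.1)) ∨
      ((∀ p, waveMetric gM 𝓗 (ψ p)
            (meanCurvature (𝓡 k) (waveMetric gM 𝓗) ψ p) (partialV (ψ p)) ≤ 0) ∧
        BddBelow (range fun p => (ψ p).1.1))) :
    ∃ u₀ : ℝ, (∀ p, (ψ p).1.1 = u₀) ∧
      (k = n → SimplyConnectedSpace S →
        ∀ v₀ : ℝ, IsParabolic (inducedMetric (𝓡 n) (waveMetric gM 𝓗)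
          (wavefront u₀ v₀ : M → (ℝ × ℝ) × M))) := by
  obtain ⟨u₀, hu, hwavefront⟩ :=
    mainTheorem5_general gM (h𝓗.mdifferentiable (by simp)) hψ hpar hH
  exact ⟨u₀, hu, fun hk _ => hwavefront (finrank_euclideanSpace_fin.trans hk)⟩
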